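/- Let $\mathbb{F}_q$ be a finite field with $q$ elements, let $d$ be an integer with $2 \le d \le q+1$, and let $S \subset \mathbb{P}^3$ be a surface of degree $d$ defined over $\mathbb{F}_q$ (the zero locus of a nonzero homogeneous polynomial of degree $d$ with coefficients in $\mathbb{F}_q$) that has no $\mathbb{F}_q$-plane as a component. Suppose that the number of $\mathbb{F}_q$-points of $S$ is exactly $(d-1)q^2 + dq + 1$. A planar $\mathbb{F}_q$-pencil of degree $d$ with vertex $v$ is a union $l_1 \cup \dots \cup l_d$ of $d$ distinct $\mathbb{F}_q$-lines of $\mathbb{P}^3$ that lie in a common plane and satisfy $l_1 \cap \dots \cap l_d = \{v\}$. Then for every $\mathbb{F}_q$-point $P$ of $S$ there is a unique $\mathbb{F}_q$-plane $H$ in $\mathbb{P}^3$ such that $S \cap H$ is a planar $\mathbb{F}_q$-pencil of degree $d$ with vertex $P$. (Here $S$, $H$ and the lines $l_i$ are algebraic sets, that is, sets of points over an algebraic closure of $\mathbb{F}_q$.) -/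

import Mathlib

namespace FqSurface

open scoped LinearAlgebra.Projectivization

/-- The `E`-points of projective three-space, for a field `E`. -/
abbrev P3 (E : Type*) [Field E] : Type _ := ℙ E (Fin 4 → E)

/-- A vector of `K⁴` seen in `E⁴`, for a field extension `E` of `K`. -/
def extendVec {K : Type*} (E : Type*) [Field K] [Field E] [Algebra K E]
    (v : Fin 4 → K) : Fin 4 → E :=
  fun i => algebraMap K E (v i)

theorem extendVec_ne_zero {K : Type*} (E : Type*) [Field K] [Field E] [Algebra K E]
    {v : Fin 4 → K} (hv : v ≠ 0) : extendVec E v ≠ 0 := by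
  intro h
  apply hv
  funext i
  have hi : algebraMap K E (v i) = 0 := congrFun h i
  simpa using hi

/-- A `K`-point of projective three-space seen as an `E`-point. -/
noncomputable def extendPoint {K : Type*} (E : Type*) [Field K] [Field E] [Algebra K E]
    (P : P3 K) : P3 E :=
  Projectivization.mk E (extendVec E P.rep) (extendVec_ne_zero E P.rep_nonzero)

/-- The set `S(E)` of `E`-points of the surface `S = {F = 0}`, where `F` is a form over `K`
and `E` is a field extension of `K`. The case `E = K` gives the `K`-points of `S`; the case of
an algebraic closure `E` gives the algebraic set `S` itself. -/
def surfacePoints {K : Type*} (E : Type*) [Field K] [Field E] [Algebra K E]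
    (F : MvPolynomial (Fin 4) K) : Set (P3 E) :=
  {x | MvPolynomial.aeval x.rep F = 0}

/-- For a form `F`, membership can be tested on any representative. -/
theorem mk_mem_surfacePoints {K : Type*} (E : Type*) [Field K] [Field E] [Algebra K E]
    {F : MvPolynomial (Fin 4) K} {d : ℕ} (hF : F.IsHomogeneous d)
    (v : Fin 4 → E) (hv : v ≠ 0) :
    Projectivization.mk E v hv ∈ surfacePoints E F ↔ MvPolynomial.aeval v F = 0 := by
  obtain ⟨a, ha⟩ := Projectivization.exists_smul_eq_mk_rep E v hv
  have h : MvPolynomial.aeval ((a : E) • v) F = (a : E) ^ d * MvPolynomial.aeval v F := by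
    rw [MvPolynomial.aeval_def, MvPolynomial.aeval_def, MvPolynomial.eval₂_eq,
      MvPolynomial.eval₂_eq, Finset.mul_sum]
    refine Finset.sum_congr rfl fun m hm => ?_
    have hd : ∑ i ∈ m.support, m i = d := by
      have := hF (MvPolynomial.mem_support_iff.mp hm)
      simpa [Finsupp.weight_apply, Finsupp.sum] using this
    simp only [Pi.smul_apply, smul_eq_mul, mul_pow, Finset.prod_mul_distrib,
      Finset.prod_pow_eq_pow_sum, hd]
    ring
  have ha' : (Projectivization.mk E v hv).rep = (a : E) • v := ha.symm
  simp only [surfacePoints, Set.mem_ofPred_eq, ha', h]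
  simp

/-- The set of `E`-points of the linear subvariety of projective three-space given by a linear
subspace `W` of `K⁴`. A `K`-line is a `W` of dimension `2`, a `K`-plane is a `W` of
dimension `3`. -/
def linearPoints {K : Type*} (E : Type*) [Field K] [Field E] [Algebra K E]
    (W : Submodule K (Fin 4 → K)) : Set (P3 E) :=
  {x | x.rep ∈ Submodule.span E (extendVec E '' (W : Set (Fin 4 → K)))}

/-- `l` is a `K`-line of projective three-space. -/
def IsLine {K : Type*} [Field K] (l : Submodule K (Fin 4 → K)) : Prop :=
  Module.finrank K l = 2

/-- `H` is a `K`-plane of projective three-space. -/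
def IsPlane {K : Type*} [Field K] (H : Submodule K (Fin 4 → K)) : Prop :=
  Module.finrank K H = 3

/-- The surface `{F = 0}` has no component that is a `K`-plane. As `{F = 0}` is purely
two-dimensional, a plane is a component of it exactly when it is contained in it (over an
algebraic closure). -/
def NoPlaneComponent {K : Type*} [Field K] (F : MvPolynomial (Fin 4) K) : Prop :=
  ∀ H : Submodule K (Fin 4 → K), IsPlane H →
    ¬ linearPoints (AlgebraicClosure K) H ⊆ surfacePoints (AlgebraicClosure K) F

/-- The algebraic set `Z` (given by its points over an algebraic closure) is a planar
`K`-pencil of degree `d` with vertex `P`: it is the union of `d ≥ 2` distinct coplanar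
`K`-lines, the intersection of which is the single point `P`. -/
def IsPlanarPencil {K : Type*} [Field K] (d : ℕ) (Z : Set (P3 (AlgebraicClosure K)))
    (P : P3 K) : Prop :=
  2 ≤ d ∧
  ∃ l : Fin d → Submodule K (Fin 4 → K),
    Function.Injective l ∧
    (∀ i, IsLine (l i)) ∧
    (∃ H : Submodule K (Fin 4 → K), IsPlane H ∧ ∀ i, l i ≤ H) ∧
    Z = (⋃ i, linearPoints (AlgebraicClosure K) (l i)) ∧
    (⋂ i, linearPoints (AlgebraicClosure K) (l i)) = {extendPoint (AlgebraicClosure K) P}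

end FqSurface

/-! Write `q` for the size of `K`. A line through a `K`-point `P` of `S` that is not contained in
`S` carries at most `d - 1` further `K`-points of `S`, and at most `d - 2` if it is tangent at `P`.
If no `K`-line of `S` passed through `P`, then `S` would have too few points
(`exists_vanishesOn_of_card_zeros`). So some `K`-line `l` of `S` contains `P`.

A plane section containing `l` has at most `(d - 1) q` points off `l`. Either it has a `K`-point on
none of its lines, and the tangent count at that point gives a strict bound, or its `K`-points are
covered by its at most `d` lines (`card_zeros_sdiff_le`). The `q + 1` planes through `l` partition
the points off `l`, and the assumed number of points makes these exactly `(q + 1)(d - 1) q`. Hence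
every plane through `l` attains the bound and contains `d` lines of `S` (`card_zeros_sdiff_eq`).

In a plane through `l` tangent at `P`, counting from `P` gives a second line of `S` through `P`. A
line of the section missing `P` would meet that second line in a point off `l` that is counted
twice, contradicting equality. So all `d` lines pass through `P` (`card_linesIn_eq_and_mem`). They
make up the section over the algebraic closure, because a form of degree `d` vanishing on `d` lines
of a plane and at one more point vanishes on the plane (`eval_eq_zero_of_vanish_on_lines`).

A pencil plane with vertex `P` is spanned by two lines of `S` through `P`, hence tangent there. Two
such planes would make `P` singular. Then the plane through `l` tangent at another point `Q` of `l`
is tangent at `P` too, and its `d ≥ 2` distinct lines would all contain both `P` and `Q`. -/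

namespace FqSurface

/-! ### The restriction of a form to a parametrized line -/

/-- The polynomial `t ↦ F (v + t p)`. -/
noncomputable def linePoly {σ R : Type*} [CommRing R] (F : MvPolynomial σ R) (v p : σ → R) :
    Polynomial R :=
  MvPolynomial.aeval (fun i => Polynomial.C (v i) + Polynomial.X * Polynomial.C (p i)) F

theorem aeval_linePoly {σ R A : Type*} [CommRing R] [CommRing A] [Algebra R A]
    (F : MvPolynomial σ R) (v p : σ → R) (t : A) :
    Polynomial.aeval t (linePoly F v p) =
      MvPolynomial.aeval (fun i => algebraMap R A (v i) + t * algebraMap R A (p i)) F := by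
  rw [linePoly, ← AlgHom.comp_apply, MvPolynomial.comp_aeval]
  simp [mul_comm t]

theorem eval_linePoly {σ R : Type*} [CommRing R] (F : MvPolynomial σ R) (v p : σ → R) (t : R) :
    (linePoly F v p).eval t = MvPolynomial.aeval (v + t • p) F := by
  rw [← Polynomial.coe_aeval_eq_eval, aeval_linePoly]
  rfl

/-- The differential of `F` at `p`. -/
noncomputable def differential {σ R : Type*} [CommRing R] [Fintype σ] (F : MvPolynomial σ R)
    (p : σ → R) : (σ → R) →ₗ[R] R where
  toFun v := ∑ i, v i * MvPolynomial.eval p (MvPolynomial.pderiv i F)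
  map_add' v w := by simp [add_mul, Finset.sum_add_distrib]
  map_smul' c v := by simp [Finset.mul_sum, mul_assoc]

theorem differential_apply {σ R : Type*} [CommRing R] [Fintype σ] (F : MvPolynomial σ R)
    (p v : σ → R) :
    differential F p v = ∑ i, v i * MvPolynomial.eval p (MvPolynomial.pderiv i F) := rfl

theorem linePoly_add {σ R : Type*} [CommRing R] (F G : MvPolynomial σ R) (v p : σ → R) :
    linePoly (F + G) v p = linePoly F v p + linePoly G v p := by
  simp [linePoly]

theorem differential_add {σ R : Type*} [CommRing R] [Fintype σ] (F G : MvPolynomial σ R)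
    (p v : σ → R) : differential (F + G) p v = differential F p v + differential G p v := by
  simp [differential_apply, mul_add, Finset.sum_add_distrib]

theorem differential_mul_X {σ R : Type*} [CommRing R] [Fintype σ] (F : MvPolynomial σ R)
    (j : σ) (p v : σ → R) :
    differential (F * MvPolynomial.X j) p v =
      differential F p v * p j + MvPolynomial.eval p F * v j := by
  classical
  simp only [differential_apply, Derivation.leibniz, MvPolynomial.pderiv_X, smul_eq_mul, map_add,
    map_mul, MvPolynomial.eval_X, mul_add, Finset.sum_add_distrib, Finset.sum_mul]
  rw [add_comm]
  congr 1
  · exact Finset.sum_congr rfl fun i _ => by ring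
  · rw [Finset.sum_eq_single j]
    · simp [mul_comm]
    · intro i _ hij
      simp [Ne.symm hij]
    · simp

/-- The top coefficients of `t ↦ F (v + t p)` for a form `F` of degree `e`: the one of `t ^ e` is
`F p`, the one of `t ^ (e - 1)` is the differential of `F` at `p`, applied to `v`. -/
def TopCoeffs {σ R : Type*} [CommRing R] [Fintype σ] (F : MvPolynomial σ R) (v p : σ → R)
    (e : ℕ) : Prop :=
  (linePoly F v p).natDegree ≤ e ∧
    (linePoly F v p).coeff e = MvPolynomial.eval p F ∧
    -- The factor `X` shifts degrees, so that for `e = 0` the coefficient of index `e - 1` reads as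
    -- `0`.
    (Polynomial.X * linePoly F v p).coeff e = differential F p v

/-- `TopCoeffs` is additive in the form for a fixed `e`, so monomials suffice. Multiplication by a
variable is the Leibniz rule on both sides. -/
theorem topCoeffs_monomial {σ R : Type*} [CommRing R] [Fintype σ] (s : σ →₀ ℕ) (a : R)
    (v p : σ → R) :
    ∃ e, (MvPolynomial.monomial s a).IsHomogeneous e ∧
      TopCoeffs (MvPolynomial.monomial s a) v p e := by
  revert s a
  refine MvPolynomial.induction_on_monomial (fun a => ?_) ?_
  · exact ⟨0, MvPolynomial.isHomogeneous_C _ _, by simp [linePoly],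
      by simp [linePoly], by simp [differential_apply]⟩
  · rintro F j ⟨e, he, h1, h2, h3⟩
    have hmul : linePoly (F * MvPolynomial.X j) v p =
        Polynomial.C (v j) * linePoly F v p +
          Polynomial.X * (Polynomial.C (p j) * linePoly F v p) := by
      simp only [linePoly, map_mul, MvPolynomial.aeval_X]
      ring
    refine ⟨e + 1, he.mul (MvPolynomial.isHomogeneous_X _ _), ?_, ?_, ?_⟩
    · rw [hmul]
      refine Polynomial.natDegree_add_le_of_degree_le
        ((Polynomial.natDegree_C_mul_le _ _).trans (by omega)) ?_
      refine Polynomial.natDegree_mul_le.trans ?_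
      have := (Polynomial.natDegree_C_mul_le (p j) (linePoly F v p)).trans h1
      have := Polynomial.natDegree_X_le (R := R)
      omega
    · rw [hmul, Polynomial.coeff_add, Polynomial.coeff_X_mul, Polynomial.coeff_C_mul,
        Polynomial.coeff_C_mul, h2,
        Polynomial.coeff_eq_zero_of_natDegree_lt (Nat.lt_succ_of_le h1)]
      simp [mul_comm]
    · rw [Polynomial.coeff_X_mul, hmul, differential_mul_X, Polynomial.coeff_add,
        Polynomial.coeff_C_mul, h2, mul_left_comm Polynomial.X, Polynomial.coeff_C_mul, h3]
      ring

theorem topCoeffs_of_isHomogeneous {σ R : Type*} [CommRing R] [Fintype σ]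
    {F : MvPolynomial σ R} {d : ℕ} (hF : F.IsHomogeneous d) (v p : σ → R) :
    TopCoeffs F v p d := by
  classical
  have key : ∀ S : Finset (σ →₀ ℕ), S ⊆ F.support →
      TopCoeffs (∑ s ∈ S, MvPolynomial.monomial s (F.coeff s)) v p d := by
    intro S
    induction S using Finset.induction_on with
    | empty => intro; simp [TopCoeffs, linePoly, differential_apply]
    | insert s S hs ih =>
      intro hS
      obtain ⟨h1, h2, h3⟩ := ih ((Finset.subset_insert _ _).trans hS)
      have hne := MvPolynomial.mem_support_iff.mp (hS (Finset.mem_insert_self s S))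
      obtain ⟨e, he, g1, g2, g3⟩ := topCoeffs_monomial s (F.coeff s) v p
      have hed : e = d := by
        rw [← he (by simpa using hne : (MvPolynomial.monomial s (F.coeff s)).coeff s ≠ 0),
          ← hF hne]
      subst hed
      rw [Finset.sum_insert hs]
      refine ⟨?_, ?_, ?_⟩
      · rw [linePoly_add]
        exact Polynomial.natDegree_add_le_of_degree_le g1 h1
      · rw [linePoly_add, Polynomial.coeff_add, g2, h2, map_add]
      · rw [linePoly_add, mul_add, Polynomial.coeff_add, g3, h3, differential_add]
  have := key F.support subset_rfl
  rwa [MvPolynomial.support_sum_monomial_coeff] at this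

theorem aeval_smul_of_isHomogeneous {σ R A : Type*} [CommRing R] [CommRing A] [Algebra R A]
    {F : MvPolynomial σ R} {d : ℕ} (hF : F.IsHomogeneous d) (c : A) (v : σ → A) :
    MvPolynomial.aeval (c • v) F = c ^ d * MvPolynomial.aeval v F := by
  rw [MvPolynomial.aeval_def, MvPolynomial.aeval_def, MvPolynomial.eval₂_eq,
    MvPolynomial.eval₂_eq, Finset.mul_sum]
  refine Finset.sum_congr rfl fun m hm => ?_
  have hd : ∑ i ∈ m.support, m i = d := by
    have := hF (MvPolynomial.mem_support_iff.mp hm)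
    simpa [Finsupp.weight_apply, Finsupp.sum] using this
  simp only [Pi.smul_apply, smul_eq_mul, mul_pow, Finset.prod_mul_distrib,
    Finset.prod_pow_eq_pow_sum, hd]
  ring

/-! ### Extension of scalars for subspaces of `K⁴` -/

section Extend

variable {K : Type*} (E : Type*) [Field K] [Field E] [Algebra K E]

/-- The subspace of `E⁴` spanned by a subspace of `K⁴`. -/
def extendSubmodule (W : Submodule K (Fin 4 → K)) : Submodule E (Fin 4 → E) :=
  Submodule.span E (extendVec E '' (W : Set (Fin 4 → K)))

theorem extendVec_add (v w : Fin 4 → K) :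
    extendVec E (v + w) = extendVec E v + extendVec E w := by
  ext i; simp [extendVec]

theorem extendVec_smul (c : K) (v : Fin 4 → K) :
    extendVec E (c • v) = algebraMap K E c • extendVec E v := by
  ext i; simp [extendVec]

theorem extendVec_zero : extendVec E (0 : Fin 4 → K) = 0 := by
  ext i; simp [extendVec]

theorem extendVec_mem_extendSubmodule_of_mem {W : Submodule K (Fin 4 → K)} {v : Fin 4 → K}
    (hv : v ∈ W) : extendVec E v ∈ extendSubmodule E W :=
  Submodule.subset_span ⟨v, hv, rfl⟩

theorem extendSubmodule_mono {W W' : Submodule K (Fin 4 → K)} (h : W ≤ W') :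
    extendSubmodule E W ≤ extendSubmodule E W' :=
  Submodule.span_mono (Set.image_mono h)

theorem extendSubmodule_span (s : Set (Fin 4 → K)) :
    extendSubmodule E (Submodule.span K s) = Submodule.span E (extendVec E '' s) := by
  apply le_antisymm
  · refine Submodule.span_le.mpr ?_
    rintro _ ⟨v, hv, rfl⟩
    induction hv using Submodule.span_induction with
    | mem v hv => exact Submodule.subset_span ⟨v, hv, rfl⟩
    | zero => rw [extendVec_zero]; exact zero_mem _
    | add v w _ _ hv hw => rw [extendVec_add]; exact add_mem hv hw
    | smul c v _ hv => rw [extendVec_smul]; exact Submodule.smul_mem _ _ hv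
  · exact Submodule.span_mono (Set.image_mono Submodule.subset_span)

/-- A `K`-linear retraction of `E` onto `K`, applied to each coordinate, carries the extended
subspace back into `W`. -/
theorem extendVec_mem_extendSubmodule_iff {W : Submodule K (Fin 4 → K)} {v : Fin 4 → K} :
    extendVec E v ∈ extendSubmodule E W ↔ v ∈ W := by
  refine ⟨fun h => ?_, extendVec_mem_extendSubmodule_of_mem E⟩
  obtain ⟨π, hπ⟩ := (Algebra.linearMap K E).exists_leftInverse_of_injective
    (LinearMap.ker_eq_bot.mpr (FaithfulSMul.algebraMap_injective K E))
  have hπ1 : ∀ c : K, π (algebraMap K E c) = c := fun c => LinearMap.congr_fun hπ c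
  -- The retraction is not `E`-linear; the free factor `a` lets the span induction absorb scalars of
  -- `E`.
  have key : ∀ x ∈ extendSubmodule E W, ∀ a : E, (fun i => π (a * x i)) ∈ W := by
    intro x hx
    induction hx using Submodule.span_induction with
    | mem x hx =>
      obtain ⟨w, hw, rfl⟩ := hx
      intro a
      convert W.smul_mem (π a) hw using 1
      ext i
      have : a * extendVec E w i = w i • a := by
        rw [Algebra.smul_def, mul_comm]; rfl
      rw [this, map_smul]
      simp [mul_comm]
    | zero => intro a; convert W.zero_mem using 1; ext i; simp
    | add x y _ _ hx hy =>
      intro a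
      convert add_mem (hx a) (hy a) using 1
      ext i; simp [mul_add]
    | smul c x _ hx =>
      intro a
      convert hx (a * c) using 1
      ext i; simp [mul_assoc]
  have := key _ h 1
  convert this using 1
  ext i
  rw [one_mul]
  exact (hπ1 (v i)).symm

theorem extendSubmodule_le_iff {W W' : Submodule K (Fin 4 → K)} :
    extendSubmodule E W ≤ extendSubmodule E W' ↔ W ≤ W' :=
  ⟨fun h _ hv => (extendVec_mem_extendSubmodule_iff E).mp
    (h (extendVec_mem_extendSubmodule_of_mem E hv)), extendSubmodule_mono E⟩

theorem extendSubmodule_injective :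
    Function.Injective (extendSubmodule E : Submodule K (Fin 4 → K) → _) := fun _ _ h =>
  le_antisymm ((extendSubmodule_le_iff E).mp h.le) ((extendSubmodule_le_iff E).mp h.ge)

theorem extendSubmodule_sup (W W' : Submodule K (Fin 4 → K)) :
    extendSubmodule E (W ⊔ W') = extendSubmodule E W ⊔ extendSubmodule E W' := by
  conv_lhs => rw [← Submodule.span_eq W, ← Submodule.span_eq W', ← Submodule.span_union]
  rw [extendSubmodule_span, Set.image_union, Submodule.span_union]
  rfl

theorem extendSubmodule_top : extendSubmodule E (⊤ : Submodule K (Fin 4 → K)) = ⊤ := by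
  rw [eq_top_iff]
  intro x _
  rw [← (Pi.basisFun E (Fin 4)).sum_repr x]
  refine Submodule.sum_mem _ fun i _ => Submodule.smul_mem _ _ ?_
  convert extendVec_mem_extendSubmodule_of_mem E (W := ⊤) (v := Pi.single i (1 : K)) trivial
  ext j
  by_cases h : j = i
  · subst h; simp [extendVec]
  · simp [extendVec, h]

theorem finrank_extendSubmodule_le (W : Submodule K (Fin 4 → K)) :
    Module.finrank E (extendSubmodule E W) ≤ Module.finrank K W := by
  classical
  let b := Module.finBasis K W
  have hspan : Submodule.span K (Set.range fun i => (b i : Fin 4 → K)) = W := by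
    have := congrArg (Submodule.map W.subtype) b.span_eq
    rw [Submodule.map_span, ← Set.range_comp, Submodule.map_top, Submodule.range_subtype] at this
    exact this
  conv_lhs => rw [← hspan]
  rw [extendSubmodule_span, ← Set.range_comp]
  exact (finrank_range_le_card _).trans (by simp)

/-- The upper bounds for `W` and for a complement must both be sharp, since the two extensions
together span `E⁴`. -/
theorem finrank_extendSubmodule (W : Submodule K (Fin 4 → K)) :
    Module.finrank E (extendSubmodule E W) = Module.finrank K W := by
  obtain ⟨W', hW'⟩ := Submodule.exists_isCompl W
  have h1 := finrank_extendSubmodule_le E W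
  have h2 := finrank_extendSubmodule_le E W'
  have h3 := Submodule.finrank_add_eq_of_isCompl hW'
  have h4 := Submodule.finrank_add_le_finrank_add_finrank (extendSubmodule E W)
    (extendSubmodule E W')
  rw [← extendSubmodule_sup, hW'.sup_eq_top, extendSubmodule_top, finrank_top] at h4
  simp at h3 h4
  omega

end Extend

/-! ### Forms over an infinite field -/

section Infinite

variable {E : Type*} [Field E]

/-- Two distinct subspaces of dimension `2` meet in dimension at most `1`. -/
theorem finrank_inf_lt_two {V : Type*} [AddCommGroup V] [Module E V] [FiniteDimensional E V]
    {N N' : Submodule E V} (hN : Module.finrank E N = 2) (hN' : Module.finrank E N' = 2)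
    (h : N ≠ N') : Module.finrank E ↥(N ⊓ N') < 2 := by
  by_contra! hc
  have h1 : N ⊓ N' = N := Submodule.eq_of_le_of_finrank_le inf_le_left (by omega)
  have h2 : N ⊓ N' = N' := Submodule.eq_of_le_of_finrank_le inf_le_right (by omega)
  exact h (h1.symm.trans h2)

/-- A subspace over an infinite field is not covered by finitely many subspaces not
containing it. -/
theorem exists_mem_forall_notMem [Infinite E] {V ι : Type*} [AddCommGroup V] [Module E V]
    [Finite ι] (M : Submodule E V) (N : ι → Submodule E V) (h : ∀ i, ¬ M ≤ N i) :
    ∃ y ∈ M, ∀ i, y ∉ N i := by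
  by_contra! hc
  obtain ⟨i, hi⟩ := Subspace.exists_eq_top_of_iUnion_eq_univ
    (p := fun i => (N i).comap M.subtype) (by
      rw [Set.eq_univ_iff_forall]
      intro y
      obtain ⟨i, hi⟩ := hc y y.2
      exact Set.mem_iUnion.mpr ⟨i, hi⟩)
  exact h i fun y hy => by
    have : (⟨y, hy⟩ : M) ∈ (N i).comap M.subtype := hi ▸ Submodule.mem_top
    exact this

/-- If a form of degree `d` vanishes on `d` distinct lines of a plane and at a further point of
the plane, then it vanishes on the plane. -/
theorem eval_eq_zero_of_vanish_on_lines [Infinite E] {d : ℕ} {F : MvPolynomial (Fin 4) E}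
    (hF : F.IsHomogeneous d) {M : Submodule E (Fin 4 → E)} (hM : Module.finrank E M = 3)
    {ι : Type*} [Fintype ι] (hι : Fintype.card ι = d) {N : ι → Submodule E (Fin 4 → E)}
    (hinj : Function.Injective N)
    (hN : ∀ i, Module.finrank E (N i) = 2) (hNM : ∀ i, N i ≤ M)
    (hzero : ∀ i, ∀ x ∈ N i, MvPolynomial.aeval x F = 0)
    {x : Fin 4 → E} (hxM : x ∈ M) (hxN : ∀ i, x ∉ N i) (hx : MvPolynomial.aeval x F = 0) :
    ∀ y ∈ M, MvPolynomial.aeval y F = 0 := by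
  classical
  -- For `y` outside these subspaces, the line joining `x` to `y` avoids the pairwise intersections
  -- of the `d` lines and meets them in `d` distinct points.
  let B : {ij : ι × ι // ij.1 ≠ ij.2} → Submodule E (Fin 4 → E) := fun ij =>
    (N ij.1.1 ⊓ N ij.1.2) ⊔ Submodule.span E {x}
  have hB : ∀ ij, ¬ M ≤ B ij := by
    intro ij hle
    have h1 := Submodule.finrank_mono hle
    have h2 := Submodule.finrank_add_le_finrank_add_finrank (N ij.1.1 ⊓ N ij.1.2)
      (Submodule.span E {x})
    have h3 := finrank_inf_lt_two (hN ij.1.1) (hN ij.1.2) fun h => ij.2 (hinj h)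
    have h4 : Module.finrank E (Submodule.span E {x}) ≤ 1 := by
      simpa using finrank_span_le_card (R := E) ({x} : Set (Fin 4 → E))
    have h5 : Module.finrank E (B ij) ≤
      Module.finrank E ↥(N ij.1.1 ⊓ N ij.1.2) + Module.finrank E (Submodule.span E {x}) := h2
    omega
  have hgen : ∀ y ∈ M, (∀ ij, y ∉ B ij) → MvPolynomial.aeval y F = 0 := by
    intro y hy hyB
    have ht : ∀ i, ∃ t : E, y + t • x ∈ N i := by
      intro i
      have hsup : N i ⊔ Submodule.span E {x} = M := by
        apply Submodule.eq_of_le_of_finrank_le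
        · exact sup_le (hNM i) (by simpa using hxM)
        · have hlt : N i < N i ⊔ Submodule.span E {x} := by
            refine lt_of_le_of_ne le_sup_left fun h => hxN i ?_
            rw [h]
            exact Submodule.mem_sup_right (Submodule.mem_span_singleton_self x)
          have := Submodule.finrank_lt_finrank_of_lt hlt
          rw [hN i] at this
          omega
      rw [← hsup, Submodule.mem_sup] at hy
      obtain ⟨n, hn, z, hz, rfl⟩ := hy
      obtain ⟨c, rfl⟩ := Submodule.mem_span_singleton.mp hz
      exact ⟨-c, by simpa using hn⟩
    choose t ht using ht
    have htinj : Function.Injective t := by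
      intro i j hij
      by_contra hne
      refine hyB ⟨(i, j), hne⟩ ?_
      have : y = (y + t i • x) + (-t i) • x := by simp
      rw [this]
      exact Submodule.add_mem_sup ⟨ht i, hij ▸ ht j⟩
        (Submodule.smul_mem _ _ (Submodule.mem_span_singleton_self x))
    obtain ⟨h1, h2, -⟩ := topCoeffs_of_isHomogeneous hF y x
    have hp : linePoly F y x = 0 := by
      have hev : ∀ i, (linePoly F y x).eval (t i) = 0 := fun i => by
        rw [eval_linePoly]; exact hzero i _ (ht i)
      -- There are `d` distinct roots, and the zero at `x` kills the coefficient of `t ^ d`: in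
      -- effect a root at infinity.
      by_contra hne
      have h3 : ¬ (linePoly F y x).natDegree < Fintype.card ι := fun h =>
        hne (Polynomial.eq_zero_of_natDegree_lt_card_of_eval_eq_zero _ htinj hev h)
      have h4 : (linePoly F y x).natDegree = d := by omega
      have h5 : (linePoly F y x).leadingCoeff = 0 := by
        rw [Polynomial.leadingCoeff, h4, h2]; exact hx
      exact hne (Polynomial.leadingCoeff_eq_zero.mp h5)
    have := eval_linePoly F y x 0
    rw [hp] at this
    simpa using this.symm
  -- An arbitrary `y` is moved in a general direction `z`: all but finitely many `y + t z` are
  -- general, so `F (y + t z)` vanishes identically in `t`.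
  obtain ⟨z, hzM, hzB⟩ := exists_mem_forall_notMem M B hB
  intro y hy
  have hp : linePoly F y z = 0 := by
    by_contra hne
    have hfin : {t : E | (linePoly F y z).IsRoot t}.Finite := by
      by_contra hinf
      exact hne (Polynomial.eq_zero_of_infinite_isRoot _ hinf)
    have hfin2 : (⋃ ij, {t : E | y + t • z ∈ B ij}).Finite := by
      refine Set.finite_iUnion fun ij => Set.Subsingleton.finite fun s hs t ht => ?_
      by_contra hst
      have h1 : (s - t) • z ∈ B ij := by
        have := sub_mem (show y + s • z ∈ B ij from hs) (show y + t • z ∈ B ij from ht)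
        rwa [add_sub_add_left_eq_sub, ← sub_smul] at this
      exact hzB ij ((Submodule.smul_mem_iff _ (sub_ne_zero.mpr hst)).mp h1)
    obtain ⟨t, ht⟩ := (hfin.union hfin2).exists_notMem
    refine ht (by_contra fun hc => ?_)
    simp only [Set.mem_union, Set.mem_iUnion, not_or, not_exists] at hc
    refine hc.1 ?_
    change Polynomial.eval t _ = 0
    rw [eval_linePoly]
    exact hgen _ (add_mem hy (M.smul_mem _ hzM)) hc.2
  have := eval_linePoly F y z 0
  rw [hp] at this
  simpa using this.symm

end Infinite

/-! ### Subspaces contained in a surface -/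

section Vanishing

variable {K : Type*} (E : Type*) [Field K] [Field E] [Algebra K E]

/-- The form `F` vanishes on the linear subvariety given by `W`, over the extension `E`. -/
def VanishesOn (F : MvPolynomial (Fin 4) K) (W : Submodule K (Fin 4 → K)) : Prop :=
  ∀ x ∈ extendSubmodule E W, MvPolynomial.aeval x F = 0

variable {E} {F : MvPolynomial (Fin 4) K} {d : ℕ}

theorem VanishesOn.mono {W W' : Submodule K (Fin 4 → K)} (h : VanishesOn E F W')
    (hle : W ≤ W') : VanishesOn E F W :=
  fun x hx => h x (extendSubmodule_mono E hle hx)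

theorem aeval_extendVec (v : Fin 4 → K) :
    MvPolynomial.aeval (extendVec E v) F = algebraMap K E (MvPolynomial.aeval v F) :=
  MvPolynomial.aeval_algebraMap_apply E v F

theorem VanishesOn.aeval_eq_zero {W : Submodule K (Fin 4 → K)} (h : VanishesOn E F W)
    {v : Fin 4 → K} (hv : v ∈ W) : MvPolynomial.aeval v F = 0 := by
  have := h _ (extendVec_mem_extendSubmodule_of_mem E hv)
  rw [aeval_extendVec] at this
  simpa using this

theorem aeval_linePoly_extendVec (v p : Fin 4 → K) (t : E) :
    Polynomial.aeval t (linePoly F v p) =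
      MvPolynomial.aeval (extendVec E v + t • extendVec E p) F :=
  aeval_linePoly F v p t

/-- Vanishing over the infinite field `E` makes the restriction zero as a polynomial, which
vanishing at `K`-points alone need not do. -/
theorem VanishesOn.linePoly_eq_zero [Infinite E] {W : Submodule K (Fin 4 → K)}
    (h : VanishesOn E F W) {v p : Fin 4 → K} (hv : v ∈ W) (hp : p ∈ W) :
    linePoly F v p = 0 := by
  have h0 : (linePoly F v p).map (algebraMap K E) = 0 := by
    refine Polynomial.funext fun t => ?_
    rw [Polynomial.eval_map_algebraMap, aeval_linePoly_extendVec, Polynomial.eval_zero]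
    exact h _ (add_mem (extendVec_mem_extendSubmodule_of_mem E hv)
      (Submodule.smul_mem _ _ (extendVec_mem_extendSubmodule_of_mem E hp)))
  exact (Polynomial.map_eq_zero _).mp h0

/-- The only point of the line missed by `v + t p` is `p`, where the value of `F` is the coefficient
of `t ^ d`. -/
theorem vanishesOn_span_pair (hF : F.IsHomogeneous d) {v p : Fin 4 → K}
    (h : linePoly F v p = 0) : VanishesOn E F (Submodule.span K {p, v}) := by
  intro x hx
  rw [extendSubmodule_span, Set.image_pair, Submodule.mem_span_pair] at hx
  obtain ⟨a, b, rfl⟩ := hx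
  have hp : MvPolynomial.aeval p F = 0 := by
    have := (topCoeffs_of_isHomogeneous hF v p).2.1
    rw [h] at this
    exact this.symm
  by_cases hb : b = 0
  · rw [hb, zero_smul, add_zero, aeval_smul_of_isHomogeneous hF, aeval_extendVec, hp]
    simp
  · have h1 : a • extendVec E p + b • extendVec E v =
        b • (extendVec E v + (b⁻¹ * a) • extendVec E p) := by
      rw [smul_add, smul_smul, mul_inv_cancel_left₀ hb, add_comm]
    rw [h1, aeval_smul_of_isHomogeneous hF, ← aeval_linePoly_extendVec, h]
    simp

theorem VanishesOn.differential_eq_zero [Infinite E] (hF : F.IsHomogeneous d)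
    {W : Submodule K (Fin 4 → K)} (h : VanishesOn E F W) {v p : Fin 4 → K}
    (hv : v ∈ W) (hp : p ∈ W) : differential F p v = 0 := by
  have := (topCoeffs_of_isHomogeneous hF v p).2.2
  rw [h.linePoly_eq_zero hv hp] at this
  simpa using this.symm

theorem VanishesOn.le_ker_differential [Infinite E] (hF : F.IsHomogeneous d)
    {W : Submodule K (Fin 4 → K)} (h : VanishesOn E F W) {p : Fin 4 → K} (hp : p ∈ W) :
    W ≤ LinearMap.ker (differential F p) :=
  fun _ hv => h.differential_eq_zero hF hv hp

/-- If a plane that is not contained in a surface of degree `d` meets it in `d` distinct lines,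
then it meets it in nothing else. -/
theorem exists_mem_of_card_eq [Infinite E] (hF : F.IsHomogeneous d)
    {H : Submodule K (Fin 4 → K)} (hH : Module.finrank K H = 3) (hHF : ¬ VanishesOn E F H)
    {ι : Type*} [Fintype ι] (hι : Fintype.card ι = d) {W : ι → Submodule K (Fin 4 → K)}
    (hinj : Function.Injective W) (hW : ∀ i, Module.finrank K (W i) = 2) (hWH : ∀ i, W i ≤ H)
    (hWF : ∀ i, VanishesOn E F (W i)) {x : Fin 4 → E} (hx : x ∈ extendSubmodule E H)
    (hxF : MvPolynomial.aeval x F = 0) : ∃ i, x ∈ extendSubmodule E (W i) := by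
  by_contra! hc
  refine hHF fun y hy => ?_
  have hmap : ∀ z : Fin 4 → E, MvPolynomial.aeval z (MvPolynomial.map (algebraMap K E) F) =
      MvPolynomial.aeval z F := fun z => MvPolynomial.aeval_map_algebraMap E z F
  rw [← hmap]
  exact eval_eq_zero_of_vanish_on_lines (hF.map _) ((finrank_extendSubmodule E H).trans hH) hι
    (N := fun i => extendSubmodule E (W i))
    (fun i j h => hinj (extendSubmodule_injective E h))
    (fun i => (finrank_extendSubmodule E _).trans (hW i))
    (fun i => extendSubmodule_mono E (hWH i)) (fun i z hz => (hmap z).trans (hWF i z hz))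
    hx hc ((hmap x).trans hxF) y hy

/-- A plane that is not contained in a surface of degree `d` contains at most `d` lines of it. -/
theorem card_lines_le [Infinite E] (hF : F.IsHomogeneous d)
    {H : Submodule K (Fin 4 → K)} (hH : Module.finrank K H = 3) (hHF : ¬ VanishesOn E F H)
    (A : Finset (Submodule K (Fin 4 → K))) (hA : ∀ W ∈ A, Module.finrank K W = 2 ∧ W ≤ H ∧
      VanishesOn E F W) : A.card ≤ d := by
  classical
  by_contra! hc
  obtain ⟨B, hBA, hB⟩ := Finset.exists_subset_card_eq hc.le
  obtain ⟨W, hWA, hWB⟩ := Finset.exists_mem_notMem_of_card_lt_card (hB ▸ hc)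
  -- Over the infinite field `E`, a further line `W` has a point on none of the `d` lines of `B`.
  obtain ⟨x, hxW, hxB⟩ := exists_mem_forall_notMem (extendSubmodule E W)
    (fun i : B => extendSubmodule E i.1) fun i hle => hWB <| by
      have h1 := (extendSubmodule_le_iff E).mp hle
      have h2 : W = i.1 := Submodule.eq_of_le_of_finrank_le h1
        (by rw [(hA _ hWA).1, (hA _ (hBA i.2)).1])
      exact h2 ▸ i.2
  obtain ⟨i, hi⟩ := exists_mem_of_card_eq hF hH hHF (ι := B) (by simpa using hB)
    (W := fun i => i.1) Subtype.val_injective (fun i => (hA _ (hBA i.2)).1)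
    (fun i => (hA _ (hBA i.2)).2.1) (fun i => (hA _ (hBA i.2)).2.2)
    (extendSubmodule_mono E (hA _ hWA).2.1 hxW) ((hA _ hWA).2.2 x hxW)
  exact hxB i hi

end Vanishing

/-! ### Counting zeros over a finite field -/

section Counting

open scoped Classical

variable {K : Type*} [Field K] [Fintype K] {E : Type*} [Field E] [Algebra K E]
  {F : MvPolynomial (Fin 4) K} {d : ℕ}

/-- The vectors of a subspace. -/
noncomputable def vecs (W : Submodule K (Fin 4 → K)) : Finset (Fin 4 → K) :=
  Finset.univ.filter (· ∈ W)

/-- The zeros of a form in a subspace. -/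
noncomputable def zeros (F : MvPolynomial (Fin 4) K) (W : Submodule K (Fin 4 → K)) :
    Finset (Fin 4 → K) :=
  (vecs W).filter fun v => MvPolynomial.aeval v F = 0

@[simp] theorem mem_vecs {W : Submodule K (Fin 4 → K)} {v : Fin 4 → K} :
    v ∈ vecs W ↔ v ∈ W := by
  simp [vecs]

theorem mem_zeros {W : Submodule K (Fin 4 → K)} {v : Fin 4 → K} :
    v ∈ zeros F W ↔ v ∈ W ∧ MvPolynomial.aeval v F = 0 := by
  rw [zeros, Finset.mem_filter, mem_vecs]

theorem vecs_mono {W W' : Submodule K (Fin 4 → K)} (h : W ≤ W') : vecs W ⊆ vecs W' :=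
  fun _ hv => mem_vecs.mpr (h (mem_vecs.mp hv))

theorem card_vecs (W : Submodule K (Fin 4 → K)) :
    (vecs W).card = Fintype.card K ^ Module.finrank K W := by
  rw [← Nat.card_eq_fintype_card, ← Module.natCard_eq_pow_finrank (K := K) (V := W),
    Nat.card_eq_fintype_card, vecs, Fintype.card_subtype]

theorem VanishesOn.vecs_subset_zeros {W H : Submodule K (Fin 4 → K)} (h : VanishesOn E F W)
    (hle : W ≤ H) : vecs W ⊆ zeros F H := fun _ hv =>
  mem_zeros.mpr ⟨hle (mem_vecs.mp hv), h.aeval_eq_zero (mem_vecs.mp hv)⟩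

/-- The number of zeros of `F` on the affine line through `v` with direction `p`. -/
noncomputable def lineCount (F : MvPolynomial (Fin 4) K) (p v : Fin 4 → K) : ℕ :=
  (Finset.univ.filter fun t : K => MvPolynomial.aeval (v + t • p) F = 0).card

theorem lineCount_le_card (p v : Fin 4 → K) : lineCount F p v ≤ Fintype.card K :=
  Finset.card_le_univ _

theorem lineCount_le_natDegree {p v : Fin 4 → K} (h : linePoly F v p ≠ 0) :
    lineCount F p v ≤ (linePoly F v p).natDegree := by
  by_contra! hc
  refine h (Polynomial.eq_zero_of_natDegree_lt_card_of_eval_eq_zero' _ _ (fun t ht => ?_) hc)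
  rw [eval_linePoly]
  exact (Finset.mem_filter.mp ht).2

theorem natDegree_le_sub_one_of_coeff_eq_zero {R : Type*} [Semiring R] {f : Polynomial R} {n : ℕ}
    (h : f.natDegree ≤ n) (h0 : f.coeff n = 0) : f.natDegree ≤ n - 1 := by
  rcases n with _ | n
  · simpa using h
  · refine Polynomial.natDegree_le_iff_coeff_eq_zero.mpr fun N hN => ?_
    rcases (show n + 1 ≤ N by omega).eq_or_lt with rfl | hlt
    · exact h0
    · exact Polynomial.coeff_eq_zero_of_natDegree_lt (h.trans_lt hlt)

/-- A line through a zero `p` of `F` that is not contained in the surface carries at most `d - 1`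
further zeros, and at most `d - 2` of them if it is tangent at `p`. -/
theorem lineCount_le (hd : 2 ≤ d) (hF : F.IsHomogeneous d) {p v : Fin 4 → K}
    (hp : MvPolynomial.aeval p F = 0) (h : ¬ VanishesOn E F (Submodule.span K {p, v})) :
    lineCount F p v + (if differential F p v = 0 then 1 else 0) ≤ d - 1 := by
  have hne : linePoly F v p ≠ 0 := fun h0 => h (vanishesOn_span_pair hF h0)
  obtain ⟨h1, h2, h3⟩ := topCoeffs_of_isHomogeneous hF v p
  -- The zero at `p` removes the coefficient of `t ^ d`, and tangency also removes that of `t ^ (d -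
  -- 1)`.
  have h4 : (linePoly F v p).natDegree ≤ d - 1 :=
    natDegree_le_sub_one_of_coeff_eq_zero h1 (h2.trans hp)
  have h5 := lineCount_le_natDegree hne
  split_ifs with hdiff
  · have h6 : (linePoly F v p).coeff (d - 1) = 0 := by
      obtain ⟨e, rfl⟩ : ∃ e, d = e + 1 := ⟨d - 1, by omega⟩
      rw [Polynomial.coeff_X_mul] at h3
      simpa [hdiff] using h3
    have := natDegree_le_sub_one_of_coeff_eq_zero h4 h6
    omega
  · omega

/-- Counting the zeros in `H` off the point `p` along the lines through `p`. -/
theorem card_mul_card_zeros_sdiff {H : Submodule K (Fin 4 → K)} {p : Fin 4 → K} (hp : p ∈ H) :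
    Fintype.card K * (zeros F H \ vecs (Submodule.span K {p})).card =
      ∑ v ∈ vecs H \ vecs (Submodule.span K {p}), lineCount F p v := by
  simp only [lineCount, Finset.card_filter]
  -- For each fixed `t`, translation by `t p` permutes the vectors of `H` off the span of `p`, so
  -- all `q` values of `t` contribute equally.
  rw [Finset.sum_comm, Finset.sum_congr rfl (g := fun _ =>
    (zeros F H \ vecs (Submodule.span K {p})).card)]
  · simp
  · intro t _
    rw [← Finset.card_filter]
    have hspan : ∀ s : K, s • p ∈ Submodule.span K {p} := fun s =>
      Submodule.smul_mem _ _ (Submodule.mem_span_singleton_self p)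
    refine Finset.card_bij' (fun v _ => v + t • p) (fun v _ => v - t • p) ?_ ?_ ?_ ?_
    · intro v hv
      simp only [Finset.mem_filter, Finset.mem_sdiff, mem_vecs, mem_zeros] at hv ⊢
      refine ⟨⟨add_mem hv.1.1 (H.smul_mem _ hp), hv.2⟩, fun h => hv.1.2 ?_⟩
      simpa using sub_mem h (hspan t)
    · intro v hv
      simp only [Finset.mem_filter, Finset.mem_sdiff, mem_vecs, mem_zeros] at hv ⊢
      refine ⟨⟨sub_mem hv.1.1 (H.smul_mem _ hp), fun h => hv.2 ?_⟩, ?_⟩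
      · simpa using add_mem h (hspan t)
      · simpa using hv.1.2
    · intro v _; simp
    · intro v _; simp

theorem card_sdiff_span_singleton {H : Submodule K (Fin 4 → K)} {p : Fin 4 → K} (hp : p ∈ H)
    (hp0 : p ≠ 0) (hpF : MvPolynomial.aeval p F = 0) (hF : F.IsHomogeneous d) :
    (zeros F H \ vecs (Submodule.span K {p})).card + Fintype.card K = (zeros F H).card := by
  have h1 : vecs (Submodule.span K {p}) ⊆ zeros F H := by
    intro v hv
    obtain ⟨c, rfl⟩ := Submodule.mem_span_singleton.mp (mem_vecs.mp hv)
    rw [mem_zeros, aeval_smul_of_isHomogeneous hF, hpF]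
    exact ⟨H.smul_mem _ hp, mul_zero _⟩
  have h2 := card_vecs (Submodule.span K {p})
  rw [finrank_span_singleton hp0, pow_one] at h2
  rw [← h2]
  exact Finset.card_sdiff_add_card_eq_card h1

/-- The count at a zero `p` through which no line of `H` is contained in the surface. -/
theorem card_zeros_le_of_no_line (hd : 2 ≤ d) (hF : F.IsHomogeneous d)
    {H : Submodule K (Fin 4 → K)} {n : ℕ} (hn : Module.finrank K H = n + 1) {p : Fin 4 → K}
    (hp : p ∈ H) (hp0 : p ≠ 0) (hpF : MvPolynomial.aeval p F = 0)
    (h : ∀ v ∈ H, v ∉ Submodule.span K {p} → ¬ VanishesOn E F (Submodule.span K {p, v})) :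
    Fintype.card K * (zeros F H).card + Fintype.card K ^ n + (d - 1) * Fintype.card K ≤
      Fintype.card K ^ 2 + (d - 1) * Fintype.card K ^ (n + 1) + Fintype.card K := by
  have hspan : Submodule.span K {p} ≤ H := by simpa using hp
  have h1 : ∑ v ∈ vecs H \ vecs (Submodule.span K {p}),
      (lineCount F p v + (if differential F p v = 0 then 1 else 0)) ≤
      ∑ v ∈ vecs H \ vecs (Submodule.span K {p}), (d - 1) := by
    refine Finset.sum_le_sum fun v hv => ?_
    simp only [Finset.mem_sdiff, mem_vecs] at hv
    exact lineCount_le hd hF hpF (h v hv.1 hv.2)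
  rw [Finset.sum_add_distrib, ← card_mul_card_zeros_sdiff hp, Finset.sum_const, smul_eq_mul,
    ← Finset.card_filter] at h1
  have h2 := card_sdiff_span_singleton hp hp0 hpF hF
  have h3 := card_vecs (Submodule.span K {p})
  rw [finrank_span_singleton hp0, pow_one] at h3
  have h4 := Finset.card_sdiff_add_card_eq_card (vecs_mono hspan)
  rw [card_vecs H, hn, h3] at h4
  let M := LinearMap.ker (differential F p) ⊓ H
  -- One linear condition lowers the dimension by at most one, so at least `q ^ n - q` of the
  -- vectors counted are tangent directions.
  have h5 : n ≤ Module.finrank K M := by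
    have e1 := Submodule.finrank_sup_add_finrank_inf_eq (LinearMap.ker (differential F p)) H
    have e2 := Submodule.finrank_le (LinearMap.ker (differential F p) ⊔ H)
    have e3 := LinearMap.finrank_range_add_finrank_ker (differential F p)
    have e4 := Submodule.finrank_le (LinearMap.range (differential F p))
    have e5 : Module.finrank K M =
      Module.finrank K ↥(LinearMap.ker (differential F p) ⊓ H) := rfl
    simp at e2 e3 e4
    omega
  have h6 : vecs M ⊆ ((vecs H \ vecs (Submodule.span K {p})).filter
      fun v => differential F p v = 0) ∪ vecs (Submodule.span K {p}) := by
    intro v hv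
    obtain ⟨hv1, hv2⟩ := Submodule.mem_inf.mp (mem_vecs.mp hv)
    by_cases hvp : v ∈ Submodule.span K {p} <;> simp_all
  have h7 := (Finset.card_le_card h6).trans (Finset.card_union_le _ _)
  rw [card_vecs M, h3] at h7
  have h8 : Fintype.card K ^ n ≤ Fintype.card K ^ Module.finrank K M :=
    Nat.pow_le_pow_right Fintype.card_pos h5
  set q := Fintype.card K
  rw [mul_comm _ (d - 1)] at h1
  have h9 : (d - 1) * q ^ (n + 1) = (d - 1) * (vecs H \ vecs (Submodule.span K {p})).card +
      (d - 1) * q := by rw [← h4, mul_add]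
  have h10 : q * (zeros F H).card =
      q * (zeros F H \ vecs (Submodule.span K {p})).card + q ^ 2 := by
    rw [← h2]; ring
  omega

/-- The count at a zero `p` at which `H` is tangent, if the only line of `H` through `p` contained
in the surface is `l`. -/
theorem card_zeros_le_of_unique_line (hd : 2 ≤ d) (hF : F.IsHomogeneous d)
    {l H : Submodule K (Fin 4 → K)} (hl : Module.finrank K l = 2) (hlH : l ≤ H)
    (hH : Module.finrank K H = 3) {p : Fin 4 → K}
    (hp : p ∈ l) (hp0 : p ≠ 0) (hpF : MvPolynomial.aeval p F = 0)
    (htan : H ≤ LinearMap.ker (differential F p))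
    (h : ∀ v ∈ H, v ∉ l → ¬ VanishesOn E F (Submodule.span K {p, v})) :
    Fintype.card K * (zeros F H).card + (d - 2) * Fintype.card K ^ 2 ≤
      Fintype.card K ^ 3 + (d - 2) * Fintype.card K ^ 3 := by
  have hspan : Submodule.span K {p} ≤ l := by simpa using hp
  -- The line `l` gets the trivial bound `q`; every other line through `p` in `H` is tangent and
  -- gets `d - 2`.
  have h1 : ∑ v ∈ vecs H \ vecs (Submodule.span K {p}), lineCount F p v ≤
      ∑ v ∈ vecs H \ vecs (Submodule.span K {p}),
        ((if v ∈ l then Fintype.card K else 0) + (if v ∈ l then 0 else d - 2)) := by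
    refine Finset.sum_le_sum fun v hv => ?_
    simp only [Finset.mem_sdiff, mem_vecs] at hv
    split_ifs with hvl
    · exact lineCount_le_card _ _
    · have := lineCount_le hd hF hpF (h v hv.1 hvl)
      rw [if_pos (LinearMap.mem_ker.mp (htan hv.1))] at this
      omega
  rw [← card_mul_card_zeros_sdiff (hlH hp), Finset.sum_add_distrib, ← Finset.sum_filter,
    Finset.sum_const, smul_eq_mul, Finset.sum_congr rfl (g := fun v => if v ∉ l then d - 2 else 0)
    (fun v _ => by split_ifs <;> rfl), ← Finset.sum_filter, Finset.sum_const, smul_eq_mul] at h1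
  have h2 := card_sdiff_span_singleton (hlH hp) hp0 hpF hF
  have h3 := card_vecs (Submodule.span K {p})
  rw [finrank_span_singleton hp0, pow_one] at h3
  have h4 : (vecs H \ vecs (Submodule.span K {p})).filter (· ∈ l) =
      vecs l \ vecs (Submodule.span K {p}) := by
    ext v
    simp only [Finset.mem_filter, Finset.mem_sdiff, mem_vecs]
    exact ⟨fun h => ⟨h.2, h.1.2⟩, fun h => ⟨⟨hlH h.1, h.2⟩, h.1⟩⟩
  have h5 : (vecs H \ vecs (Submodule.span K {p})).filter (· ∉ l) = vecs H \ vecs l := by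
    ext v
    simp only [Finset.mem_filter, Finset.mem_sdiff, mem_vecs]
    exact ⟨fun h => ⟨h.1.1, h.2⟩, fun h => ⟨⟨h.1, fun h' => h.2 (hspan h')⟩, h.2⟩⟩
  have h6 := Finset.card_sdiff_add_card_eq_card (vecs_mono hspan)
  have h7 := Finset.card_sdiff_add_card_eq_card (vecs_mono hlH)
  rw [card_vecs l, hl, h3] at h6
  rw [card_vecs l, card_vecs H, hl, hH] at h7
  rw [h4, h5] at h1
  set q := Fintype.card K
  rw [← h2]
  have h8 : q ^ 3 = (vecs l \ vecs (Submodule.span K {p})).card * q + q ^ 2 := by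
    calc q ^ 3 = q ^ 2 * q := by ring
      _ = ((vecs l \ vecs (Submodule.span K {p})).card + q) * q := by rw [h6]
      _ = _ := by ring
  have h9 : (d - 2) * q ^ 3 = (vecs H \ vecs l).card * (d - 2) + (d - 2) * q ^ 2 := by
    rw [← h7]; ring
  have h10 : q * ((zeros F H \ vecs (Submodule.span K {p})).card + q) =
    q * (zeros F H \ vecs (Submodule.span K {p})).card + q ^ 2 := by ring
  omega

end Counting

/-! ### Planes through a line of the surface -/

section Dimension

variable {K V : Type*} [Field K] [AddCommGroup V] [Module K V] [FiniteDimensional K V]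

theorem finrank_sup_span_singleton_of_notMem {W : Submodule K V} {v : V} (hv : v ∉ W) :
    Module.finrank K ↥(W ⊔ Submodule.span K {v}) = Module.finrank K W + 1 := by
  apply le_antisymm
  · refine (Submodule.finrank_add_le_finrank_add_finrank _ _).trans ?_
    have := finrank_span_le_card (R := K) ({v} : Set V)
    simpa using this
  · refine Submodule.finrank_lt_finrank_of_lt (lt_of_le_of_ne le_sup_left fun h => hv ?_)
    rw [h]
    exact Submodule.mem_sup_right (Submodule.mem_span_singleton_self v)

theorem finrank_span_pair_of_notMem {p v : V} (hp : p ≠ 0) (hv : v ∉ Submodule.span K {p}) :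
    Module.finrank K (Submodule.span K {p, v}) = 2 := by
  rw [Submodule.span_insert, finrank_sup_span_singleton_of_notMem hv, finrank_span_singleton hp]

/-- This exchange property makes lying in a common plane through `l` symmetric for vectors off `l`,
as the double count in `card_zeros_sdiff_eq` requires. -/
theorem sup_span_singleton_eq_of_mem {W : Submodule K V} {v z : V} (hz : z ∉ W)
    (h : z ∈ W ⊔ Submodule.span K {v}) :
    W ⊔ Submodule.span K {z} = W ⊔ Submodule.span K {v} := by
  by_cases hv : v ∈ W
  · refine absurd ?_ hz
    rwa [sup_eq_left.mpr (by simpa using hv)] at h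
  · apply Submodule.eq_of_le_of_finrank_eq
    · exact sup_le le_sup_left (by simpa using h)
    · rw [finrank_sup_span_singleton_of_notMem hz, finrank_sup_span_singleton_of_notMem hv]

/-- Two lines in a plane meet. -/
theorem one_le_finrank_inf {W W' H : Submodule K V} (hW : Module.finrank K W = 2)
    (hW' : Module.finrank K W' = 2) (hH : Module.finrank K H = 3) (hWH : W ≤ H) (hWH' : W' ≤ H) :
    1 ≤ Module.finrank K ↥(W ⊓ W') := by
  have h1 := Submodule.finrank_sup_add_finrank_inf_eq W W'
  have h2 := Submodule.finrank_mono (sup_le hWH hWH')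
  omega

/-- Two distinct lines through a point meet only there. -/
theorem inf_eq_span_singleton {W W' : Submodule K V} (hW : Module.finrank K W = 2)
    (hW' : Module.finrank K W' = 2) (hne : W ≠ W') {p : V} (hp : p ≠ 0) (hpW : p ∈ W)
    (hpW' : p ∈ W') : W ⊓ W' = Submodule.span K {p} := by
  symm
  apply Submodule.eq_of_le_of_finrank_le
  · simpa using ⟨hpW, hpW'⟩
  · rw [finrank_span_singleton hp]
    have := finrank_inf_lt_two hW hW' hne
    omega

end Dimension

/-! ### Counting points of plane sections that contain a line -/

section Planes

open scoped Classical

variable {K : Type*} [Field K] [Fintype K] {E : Type*} [Field E] [Algebra K E]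
  {F : MvPolynomial (Fin 4) K} {d : ℕ}

variable (E) in
/-- The `K`-lines in `H` contained in the surface. -/
noncomputable def linesIn (F : MvPolynomial (Fin 4) K) (H : Submodule K (Fin 4 → K)) :
    Finset (Submodule K (Fin 4 → K)) :=
  (Set.toFinite {W : Submodule K (Fin 4 → K) | Module.finrank K W = 2 ∧ W ≤ H ∧
    VanishesOn E F W}).toFinset

theorem mem_linesIn {H W : Submodule K (Fin 4 → K)} :
    W ∈ linesIn E F H ↔ Module.finrank K W = 2 ∧ W ≤ H ∧ VanishesOn E F W := by
  simp [linesIn]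

/-- Two lines of a plane meet, so they share at least `q` vectors. -/
theorem card_vecs_sdiff_le {W l H : Submodule K (Fin 4 → K)} (hW : Module.finrank K W = 2)
    (hl : Module.finrank K l = 2) (hH : Module.finrank K H = 3) (hWH : W ≤ H) (hlH : l ≤ H) :
    (vecs W \ vecs l).card ≤ Fintype.card K ^ 2 - Fintype.card K := by
  have h1 : vecs W \ vecs l = vecs W \ vecs (W ⊓ l) := by
    ext v
    simp only [Finset.mem_sdiff, mem_vecs, Submodule.mem_inf]
    tauto
  have h2 := Finset.card_sdiff_add_card_eq_card (vecs_mono (inf_le_left : W ⊓ l ≤ W))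
  have h3 := one_le_finrank_inf hW hl hH hWH hlH
  have h4 : Fintype.card K ^ 1 ≤ Fintype.card K ^ Module.finrank K ↥(W ⊓ l) :=
    Nat.pow_le_pow_right Fintype.card_pos h3
  rw [card_vecs, card_vecs, hW] at h2
  rw [pow_one] at h4
  rw [h1]
  omega

theorem card_zeros_sdiff_add {l H : Submodule K (Fin 4 → K)} (hl : Module.finrank K l = 2)
    (hlF : VanishesOn E F l) (hlH : l ≤ H) :
    (zeros F H \ vecs l).card + Fintype.card K ^ 2 = (zeros F H).card := by
  have := Finset.card_sdiff_add_card_eq_card (hlF.vecs_subset_zeros hlH)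
  rwa [card_vecs, hl] at this

theorem sub_one_mul_sq_sub (d q : ℕ) : (d - 1) * (q ^ 2 - q) + (d - 1) * q = (d - 1) * q ^ 2 := by
  rw [← mul_add, Nat.sub_add_cancel (Nat.le_self_pow two_ne_zero q)]

/-- A plane section with a point on none of its lines has few points. -/
theorem card_zeros_sdiff_lt_of_uncovered (hd : 2 ≤ d) (hdq : d ≤ Fintype.card K + 1)
    (hF : F.IsHomogeneous d) {l H : Submodule K (Fin 4 → K)} (hl : Module.finrank K l = 2)
    (hlF : VanishesOn E F l) (hlH : l ≤ H) (hH : Module.finrank K H = 3) {r : Fin 4 → K}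
    (hr : r ∈ zeros F H) (hr' : ∀ W ∈ linesIn E F H, r ∉ W) :
    (zeros F H \ vecs l).card < (d - 1) * (Fintype.card K ^ 2 - Fintype.card K) := by
  have hr0 : r ≠ 0 := by
    rintro rfl
    exact hr' l (mem_linesIn.mpr ⟨hl, hlH, hlF⟩) l.zero_mem
  obtain ⟨hrH, hrF⟩ := mem_zeros.mp hr
  have h1 := card_zeros_le_of_no_line (E := E) hd hF (n := 2) hH hrH hr0 hrF
    fun v hv hvr hvan => hr' _ (mem_linesIn.mpr ⟨finrank_span_pair_of_notMem hr0 hvr,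
      Submodule.span_le.mpr (Set.pair_subset hrH hv), hvan⟩)
      (Submodule.subset_span (Set.mem_insert _ _))
  have h2 := card_zeros_sdiff_add hl hlF hlH
  have h3 := sub_one_mul_sq_sub d (Fintype.card K)
  have hq : 1 < Fintype.card K := Fintype.one_lt_card
  rw [← h2] at h1
  set X := (zeros F H \ vecs l).card
  set q := Fintype.card K
  set c := (d - 1) * (q ^ 2 - q)
  obtain ⟨e, rfl⟩ : ∃ e, d = e + 2 := ⟨d - 2, by omega⟩
  simp only [show e + 2 - 1 = e + 1 by omega, show 2 + 1 = 3 from rfl] at h1 h3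
  have h4 : q * (X + q ^ 2 + (e + 1)) ≤ q * ((e + 1) * q ^ 2 + 1) := by
    nlinarith
  have h5 := Nat.le_of_mul_le_mul_left h4 (by omega)
  have h6 : (e + 1) * q ≤ q * q := Nat.mul_le_mul_right q (by omega)
  -- What remains is `(d - 1) q < q ^ 2 + (d - 2)`. For `d > 2` it follows from `d - 1 ≤ q`; for `d
  -- = 2` it is `q < q ^ 2`.
  rcases Nat.eq_zero_or_pos e with rfl | he
  · have h7 : 2 * q ≤ q * q := Nat.mul_le_mul_right q hq
    nlinarith
  · nlinarith

theorem zeros_sdiff_subset_biUnion {l H : Submodule K (Fin 4 → K)}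
    (hcov : ∀ r ∈ zeros F H, ∃ W ∈ linesIn E F H, r ∈ W) :
    zeros F H \ vecs l ⊆ ((linesIn E F H).erase l).biUnion fun W => vecs W \ vecs l := by
  intro r hr
  obtain ⟨hr1, hr2⟩ := Finset.mem_sdiff.mp hr
  obtain ⟨W, hW, hrW⟩ := hcov r hr1
  refine Finset.mem_biUnion.mpr ⟨W, Finset.mem_erase.mpr ⟨?_, hW⟩,
    Finset.mem_sdiff.mpr ⟨mem_vecs.mpr hrW, hr2⟩⟩
  rintro rfl
  exact hr2 (mem_vecs.mpr hrW)

theorem card_biUnion_le_of_lines {l H : Submodule K (Fin 4 → K)} (hl : Module.finrank K l = 2)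
    (hlH : l ≤ H) (hH : Module.finrank K H = 3) {A : Finset (Submodule K (Fin 4 → K))}
    (hA : A ⊆ linesIn E F H) :
    (A.biUnion fun W => vecs W \ vecs l).card ≤
      A.card * (Fintype.card K ^ 2 - Fintype.card K) :=
  Finset.card_biUnion_le_card_mul _ _ _ fun W hW => by
    obtain ⟨h1, h2, -⟩ := mem_linesIn.mp (hA hW)
    exact card_vecs_sdiff_le h1 hl hH h2 hlH

/-- The bound for plane sections containing a line, with the case of equality. -/
theorem card_zeros_sdiff_le [Infinite E] (hd : 2 ≤ d) (hdq : d ≤ Fintype.card K + 1)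
    (hF : F.IsHomogeneous d) {l H : Submodule K (Fin 4 → K)} (hl : Module.finrank K l = 2)
    (hlF : VanishesOn E F l) (hlH : l ≤ H) (hH : Module.finrank K H = 3)
    (hHF : ¬ VanishesOn E F H) :
    (zeros F H \ vecs l).card ≤ (d - 1) * (Fintype.card K ^ 2 - Fintype.card K) ∧
      ((zeros F H \ vecs l).card = (d - 1) * (Fintype.card K ^ 2 - Fintype.card K) →
        (linesIn E F H).card = d ∧ ∀ r ∈ zeros F H, ∃ W ∈ linesIn E F H, r ∈ W) := by
  by_cases hcov : ∀ r ∈ zeros F H, ∃ W ∈ linesIn E F H, r ∈ W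
  · have h1 := (Finset.card_le_card (zeros_sdiff_subset_biUnion (l := l) hcov)).trans
      (card_biUnion_le_of_lines hl hlH hH (Finset.erase_subset _ _))
    have hmem : l ∈ linesIn E F H := mem_linesIn.mpr ⟨hl, hlH, hlF⟩
    rw [Finset.card_erase_of_mem hmem] at h1
    have h2 : (linesIn E F H).card ≤ d :=
      card_lines_le hF hH hHF _ fun W hW => mem_linesIn.mp hW
    have h3 : 0 < (linesIn E F H).card := Finset.card_pos.mpr ⟨l, hmem⟩
    refine ⟨h1.trans (Nat.mul_le_mul_right _ (by omega)), fun heq => ⟨?_, hcov⟩⟩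
    rw [heq] at h1
    have hq : 1 < Fintype.card K := Fintype.one_lt_card
    have h4 : 0 < Fintype.card K ^ 2 - Fintype.card K := by
      have : Fintype.card K ^ 1 < Fintype.card K ^ 2 := Nat.pow_lt_pow_right hq (by norm_num)
      rw [pow_one] at this
      omega
    have := Nat.le_of_mul_le_mul_right h1 h4
    omega
  · push Not at hcov
    obtain ⟨r, hr, hr'⟩ := hcov
    have := card_zeros_sdiff_lt_of_uncovered hd hdq hF hl hlF hlH hH hr hr'
    exact ⟨this.le, fun h => absurd h this.ne⟩

/-- If the surface has as many points as possible, so has each section by a plane through a line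
of the surface. -/
theorem card_zeros_sdiff_eq [Infinite E] (hd : 2 ≤ d) (hdq : d ≤ Fintype.card K + 1)
    (hF : F.IsHomogeneous d)
    (hnp : ∀ H : Submodule K (Fin 4 → K), Module.finrank K H = 3 → ¬ VanishesOn E F H)
    (hZ : (zeros F ⊤).card = 1 + (Fintype.card K - 1) *
      ((d - 1) * Fintype.card K ^ 2 + d * Fintype.card K + 1))
    {l H : Submodule K (Fin 4 → K)} (hl : Module.finrank K l = 2)
    (hlF : VanishesOn E F l) (hlH : l ≤ H) (hH : Module.finrank K H = 3) :
    (zeros F H \ vecs l).card = (d - 1) * (Fintype.card K ^ 2 - Fintype.card K) := by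
  set A := vecs (⊤ : Submodule K (Fin 4 → K)) \ vecs l with hAdef
  set B := zeros F ⊤ \ vecs l with hBdef
  have hfin : ∀ v ∈ A, Module.finrank K ↥(l ⊔ Submodule.span K {v}) = 3 := by
    intro v hv
    rw [finrank_sup_span_singleton_of_notMem (by simpa [hAdef] using hv), hl]
  have hle : ∀ v ∈ A, (zeros F (l ⊔ Submodule.span K {v}) \ vecs l).card ≤
      (d - 1) * (Fintype.card K ^ 2 - Fintype.card K) := fun v hv =>
    (card_zeros_sdiff_le hd hdq hF hl hlF le_sup_left (hfin v hv) (hnp _ (hfin v hv))).1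
  -- Planes through `l` are indexed by vectors off `l`, so each plane occurs `q ^ 3 - q ^ 2` times.
  have hdouble : ∑ v ∈ A, (zeros F (l ⊔ Submodule.span K {v}) \ vecs l).card =
      ∑ z ∈ B, (Fintype.card K ^ 3 - Fintype.card K ^ 2) := by
    have := Finset.sum_card_bipartiteAbove_eq_sum_card_bipartiteBelow
      (fun v z => z ∈ l ⊔ Submodule.span K {v}) (s := A) (t := B)
    convert this using 1
    · refine Finset.sum_congr rfl fun v _ => congrArg _ ?_
      ext z
      simp only [hBdef, Finset.bipartiteAbove, Finset.mem_filter, Finset.mem_sdiff, mem_zeros,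
        mem_vecs, Submodule.mem_top, true_and]
      tauto
    · refine Finset.sum_congr rfl fun z hz => ?_
      have hzl : z ∉ l := fun h => (Finset.mem_sdiff.mp hz).2 (mem_vecs.mpr h)
      have h1 := Finset.card_sdiff_add_card_eq_card
        (vecs_mono (le_sup_left : l ≤ l ⊔ Submodule.span K {z}))
      rw [card_vecs, card_vecs, finrank_sup_span_singleton_of_notMem hzl, hl,
        show 2 + 1 = 3 from rfl] at h1
      rw [show Fintype.card K ^ 3 - Fintype.card K ^ 2 =
        (vecs (l ⊔ Submodule.span K {z}) \ vecs l).card by omega]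
      congr 1
      ext v
      simp only [hAdef, Finset.bipartiteBelow, Finset.mem_filter, Finset.mem_sdiff,
        mem_vecs, Submodule.mem_top, true_and]
      constructor
      · rintro ⟨h2, h3⟩
        refine ⟨h3, ?_⟩
        rw [sup_span_singleton_eq_of_mem h3 h2]
        exact Submodule.mem_sup_right (Submodule.mem_span_singleton_self z)
      · rintro ⟨h2, h3⟩
        refine ⟨?_, h2⟩
        rw [sup_span_singleton_eq_of_mem hzl h3]
        exact Submodule.mem_sup_right (Submodule.mem_span_singleton_self v)
  have hA : A.card + Fintype.card K ^ 2 = Fintype.card K ^ 4 := by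
    have := Finset.card_sdiff_add_card_eq_card (vecs_mono (le_top : l ≤ ⊤))
    rw [card_vecs, card_vecs, hl, finrank_top] at this
    simpa using this
  have hB := card_zeros_sdiff_add hl hlF le_top
  have hsum : ∑ v ∈ A, (zeros F (l ⊔ Submodule.span K {v}) \ vecs l).card =
      ∑ v ∈ A, (d - 1) * (Fintype.card K ^ 2 - Fintype.card K) := by
    rw [hdouble, Finset.sum_const, Finset.sum_const, smul_eq_mul, smul_eq_mul]
    rw [← hBdef, hZ] at hB
    obtain ⟨r, hr⟩ : ∃ r, Fintype.card K = r + 1 := ⟨_, (Nat.succ_pred Fintype.card_ne_zero).symm⟩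
    obtain ⟨e, rfl⟩ : ∃ e, d = e + 1 := ⟨d - 1, by omega⟩
    rw [hr] at hA hB ⊢
    simp only [Nat.add_sub_cancel] at hB ⊢
    have h3 : (r + 1) ^ 3 - (r + 1) ^ 2 = (r + 1) ^ 2 * r := by
      rw [Nat.sub_eq_iff_eq_add (Nat.pow_le_pow_right (by omega) (by norm_num))]; ring
    have h2 : (r + 1) ^ 2 - (r + 1) = (r + 1) * r := by
      rw [Nat.sub_eq_iff_eq_add (Nat.le_self_pow two_ne_zero _)]; ring
    have hA' : A.card = (r + 1) ^ 2 * (r * (r + 2)) := by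
      have : (r + 1) ^ 4 = (r + 1) ^ 2 * (r * (r + 2)) + (r + 1) ^ 2 := by ring
      omega
    have hB' : B.card = e * (r + 1) * (r * (r + 2)) := by
      have : 1 + r * (e * (r + 1) ^ 2 + (e + 1) * (r + 1) + 1) =
        e * (r + 1) * (r * (r + 2)) + (r + 1) ^ 2 := by ring
      omega
    rw [h3, h2, hA', hB']
    ring
  -- The termwise bounds add up to the exact total, so each of them is an equality.
  have heq := (Finset.sum_eq_sum_iff_of_le hle).mp hsum
  obtain ⟨v, hvH, hvl⟩ : ∃ v ∈ H, v ∉ l := by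
    by_contra! hc
    have := Submodule.finrank_mono (show H ≤ l from hc)
    omega
  have hvA : v ∈ A := by simpa [hAdef] using hvl
  have hH' : l ⊔ Submodule.span K {v} = H :=
    Submodule.eq_of_le_of_finrank_eq (sup_le hlH (by simpa using hvH)) ((hfin v hvA).trans hH.symm)
  rw [← hH']
  exact heq v hvA

/-- Through every point of a surface with as many points as possible goes a line of the surface. -/
theorem exists_vanishesOn_of_card_zeros (hd : 2 ≤ d) (hdq : d ≤ Fintype.card K + 1)
    (hF : F.IsHomogeneous d)
    (hZ : (zeros F ⊤).card = 1 + (Fintype.card K - 1) *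
      ((d - 1) * Fintype.card K ^ 2 + d * Fintype.card K + 1))
    {p : Fin 4 → K} (hp0 : p ≠ 0) (hpF : MvPolynomial.aeval p F = 0) :
    ∃ l : Submodule K (Fin 4 → K), Module.finrank K l = 2 ∧ p ∈ l ∧ VanishesOn E F l := by
  by_contra! hc
  have h := card_zeros_le_of_no_line (E := E) (H := ⊤) (n := 3) hd hF (by simp) trivial hp0 hpF
    fun v _ hv => hc _ (finrank_span_pair_of_notMem hp0 hv)
      (Submodule.subset_span (Set.mem_insert _ _))
  have hq : 1 < Fintype.card K := Fintype.one_lt_card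
  rw [hZ] at h
  obtain ⟨r, hr⟩ : ∃ r, Fintype.card K = r + 2 := ⟨Fintype.card K - 2, by omega⟩
  obtain ⟨e, rfl⟩ : ∃ e, d = e + 2 := ⟨d - 2, by omega⟩
  rw [hr] at h hdq
  simp only [show e + 2 - 1 = e + 1 by omega, show r + 2 - 1 = r + 1 by omega,
    show 3 + 1 = 4 from rfl] at h
  -- Here `k = q + 1 - d`. The count exceeds its bound by `q ^ 2 (2 q - d) + (d - 2) q`, which is
  -- positive because `d ≤ q + 1 < 2 q`.
  obtain ⟨k, hk⟩ : ∃ k, r + 1 = e + k := ⟨r + 1 - e, by omega⟩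
  have hk2 : (r + 1) * (r + 2) ^ 2 = (e + k) * (r + 2) ^ 2 := by rw [hk]
  have hkey : (r + 2) ^ 2 * (r + 1 + k) + e * (r + 2) ≤ 0 := by
    zify at h hk2 ⊢
    linarith
  have : 0 < (r + 2) ^ 2 * (r + 1 + k) := by positivity
  omega

/-- In a plane through a line `l` of the surface that is tangent at `p ∈ l`, the surface has `d`
lines, and they go through `p`. -/
theorem card_linesIn_eq_and_mem [Infinite E] (hd : 2 ≤ d) (hdq : d ≤ Fintype.card K + 1)
    (hF : F.IsHomogeneous d)
    (hnp : ∀ H : Submodule K (Fin 4 → K), Module.finrank K H = 3 → ¬ VanishesOn E F H)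
    (hZ : (zeros F ⊤).card = 1 + (Fintype.card K - 1) *
      ((d - 1) * Fintype.card K ^ 2 + d * Fintype.card K + 1))
    {l H : Submodule K (Fin 4 → K)} (hl : Module.finrank K l = 2)
    (hlF : VanishesOn E F l) (hlH : l ≤ H) (hH : Module.finrank K H = 3)
    {p : Fin 4 → K} (hp : p ∈ l) (hp0 : p ≠ 0)
    (htan : H ≤ LinearMap.ker (differential F p)) :
    (linesIn E F H).card = d ∧ ∀ W ∈ linesIn E F H, p ∈ W := by
  have hX := card_zeros_sdiff_eq hd hdq hF hnp hZ hl hlF hlH hH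
  obtain ⟨hcard, hcov⟩ := (card_zeros_sdiff_le hd hdq hF hl hlF hlH hH (hnp H hH)).2 hX
  refine ⟨hcard, fun W hW => by_contra fun hpW => ?_⟩
  have hlmem : l ∈ linesIn E F H := mem_linesIn.mpr ⟨hl, hlH, hlF⟩
  have hq : 1 < Fintype.card K := Fintype.one_lt_card
  -- If `l` were the only line of the section through `p`, the tangent count would fall short of the
  -- known number and force `q ^ 3 ≤ q ^ 2`.
  obtain ⟨v, hvH, hvl, hvF⟩ : ∃ v ∈ H, v ∉ l ∧ VanishesOn E F (Submodule.span K {p, v}) := by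
    by_contra! hc
    have h1 := card_zeros_le_of_unique_line hd hF hl hlH hH hp hp0 (hlF.aeval_eq_zero hp) htan hc
    rw [← card_zeros_sdiff_add hl hlF hlH, hX] at h1
    have h3 := sub_one_mul_sq_sub d (Fintype.card K)
    set c := (d - 1) * (Fintype.card K ^ 2 - Fintype.card K)
    obtain ⟨e, rfl⟩ : ∃ e, d = e + 2 := ⟨d - 2, by omega⟩
    simp only [show e + 2 - 1 = e + 1 by omega, show e + 2 - 2 = e by omega] at h1 h3
    set q := Fintype.card K
    have h4 : q * (c + (e + 1) * q) = q * ((e + 1) * q ^ 2) := by rw [h3]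
    have h5 : q ^ 2 * q ≤ q ^ 2 * 1 := by nlinarith
    have := Nat.le_of_mul_le_mul_left h5 (by positivity)
    omega
  set m := Submodule.span K {p, v} with hmdef
  have hpm : p ∈ m := Submodule.subset_span (Set.mem_insert _ _)
  have hvm : v ∈ m := Submodule.subset_span (by simp)
  have hm : Module.finrank K m = 2 := finrank_span_pair_of_notMem hp0 fun h => hvl <| by
    obtain ⟨c, rfl⟩ := Submodule.mem_span_singleton.mp h
    exact l.smul_mem _ hp
  have hmH : m ≤ H := Submodule.span_le.mpr (Set.pair_subset (hlH hp) hvH)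
  have hml : l ≠ m := fun h => hvl (h ▸ hvm)
  obtain ⟨hW2, hWH, hWF⟩ := mem_linesIn.mp hW
  obtain ⟨u, hu, hu0⟩ := Submodule.exists_mem_ne_zero_of_ne_bot
    (p := W ⊓ m) (fun h => by
      have := one_le_finrank_inf hW2 hm hH hWH hmH
      rw [h, finrank_bot] at this
      omega)
  obtain ⟨huW, hum⟩ := Submodule.mem_inf.mp hu
  have hul : u ∉ l := fun hul => hpW <| by
    have h1 := inf_eq_span_singleton hl hm hml hu0 hul hum
    have h2 : p ∈ l ⊓ m := ⟨hp, hpm⟩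
    rw [h1] at h2
    obtain ⟨c, rfl⟩ := Submodule.mem_span_singleton.mp h2
    exact W.smul_mem _ huW
  have hmmem : m ∈ ((linesIn E F H).erase l).erase W :=
    Finset.mem_erase.mpr ⟨fun h => hpW (h ▸ hpm), Finset.mem_erase.mpr
      ⟨hml.symm, mem_linesIn.mpr ⟨hm, hmH, hvF⟩⟩⟩
  have hWmem : W ∈ (linesIn E F H).erase l :=
    Finset.mem_erase.mpr ⟨fun h => hpW (h ▸ hp), hW⟩
  -- The vector `u` lies on `m` as well as on `W`, so it can be dropped from `W`; this makes the
  -- union bound too small by one.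
  have hsub : zeros F H \ vecs l ⊆
      (((linesIn E F H).erase l).erase W).biUnion (fun W => vecs W \ vecs l) ∪
        (vecs W \ vecs l).erase u := by
    intro z hz
    obtain ⟨W', hW', hzW'⟩ := Finset.mem_biUnion.mp (zeros_sdiff_subset_biUnion hcov hz)
    by_cases h : W' = W
    · by_cases hzu : z = u
      · refine Finset.mem_union_left _ (Finset.mem_biUnion.mpr ⟨m, hmmem, ?_⟩)
        rw [hzu]
        simpa using ⟨hum, hul⟩
      · exact Finset.mem_union_right _ (Finset.mem_erase.mpr ⟨hzu, h ▸ hzW'⟩)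
    · exact Finset.mem_union_left _
        (Finset.mem_biUnion.mpr ⟨W', Finset.mem_erase.mpr ⟨h, hW'⟩, hzW'⟩)
  have h1 := (Finset.card_le_card hsub).trans (Finset.card_union_le _ _)
  have h2 := card_biUnion_le_of_lines (A := ((linesIn E F H).erase l).erase W) hl hlH hH
    ((Finset.erase_subset _ _).trans (Finset.erase_subset _ _))
  have h3 := card_vecs_sdiff_le hW2 hl hH hWH hlH
  have huWl : u ∈ vecs W \ vecs l := by simpa using ⟨huW, hul⟩
  have h4 := Finset.card_pos.mpr ⟨u, huWl⟩
  rw [Finset.card_erase_of_mem hWmem, Finset.card_erase_of_mem hlmem, hcard] at h2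
  rw [Finset.card_erase_of_mem huWl, hX] at h1
  obtain ⟨e, rfl⟩ : ∃ e, d = e + 2 := ⟨d - 2, by omega⟩
  simp only [show e + 2 - 1 = e + 1 by omega, show e + 1 - 1 = e by omega] at h1 h2
  rw [add_mul, one_mul] at h1
  omega

end Planes

/-! ### Points and pencils -/

section Points

variable {K : Type*} {E : Type*} [Field K] [Field E] [Algebra K E]
  {F : MvPolynomial (Fin 4) K} {d : ℕ}

theorem mk_mem_linearPoints_iff {W : Submodule K (Fin 4 → K)} (v : Fin 4 → E) (hv : v ≠ 0) :
    Projectivization.mk E v hv ∈ linearPoints E W ↔ v ∈ extendSubmodule E W := by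
  obtain ⟨a, ha⟩ := Projectivization.exists_smul_eq_mk_rep E v hv
  change (Projectivization.mk E v hv).rep ∈ extendSubmodule E W ↔ _
  rw [← ha]
  exact Submodule.smul_mem_iff _ a.ne_zero

theorem extendPoint_mem_linearPoints_iff {W : Submodule K (Fin 4 → K)} {P : P3 K} :
    extendPoint E P ∈ linearPoints E W ↔ P.rep ∈ W :=
  (mk_mem_linearPoints_iff _ _).trans (extendVec_mem_extendSubmodule_iff E)

theorem linearPoints_subset_surfacePoints_iff (hF : F.IsHomogeneous d) (hd : d ≠ 0)
    {W : Submodule K (Fin 4 → K)} :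
    linearPoints E W ⊆ surfacePoints E F ↔ VanishesOn E F W := by
  refine ⟨fun h x hx => ?_, fun h x hx => h _ hx⟩
  -- The zero vector is no projective point; there `F` vanishes because `d ≠ 0`.
  by_cases hx0 : x = 0
  · have := aeval_smul_of_isHomogeneous hF (0 : E) (0 : Fin 4 → E)
    rw [zero_pow hd, zero_mul, smul_zero] at this
    rwa [hx0]
  · exact (mk_mem_surfacePoints E hF x hx0).mp (h ((mk_mem_linearPoints_iff x hx0).mpr hx))

theorem linearPoints_subset_iff {W H : Submodule K (Fin 4 → K)} :
    linearPoints E W ⊆ linearPoints E H ↔ W ≤ H := by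
  refine ⟨fun h v hv => ?_, fun h x hx => extendSubmodule_mono E h hx⟩
  by_cases hv0 : v = 0
  · rw [hv0]; exact H.zero_mem
  · have h1 := (mk_mem_linearPoints_iff (E := E) (W := W) _ (extendVec_ne_zero E hv0)).mpr
      (extendVec_mem_extendSubmodule_of_mem E hv)
    exact (extendVec_mem_extendSubmodule_iff E).mp ((mk_mem_linearPoints_iff _ _).mp (h h1))

open scoped Classical in
/-- Passing from projective points to vectors. -/
theorem card_zeros_top [Fintype K] (hF : F.IsHomogeneous d) (hd : d ≠ 0) :
    (zeros F ⊤).card = 1 + (Fintype.card K - 1) * (surfacePoints K F).ncard := by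
  have h0 : MvPolynomial.aeval (0 : Fin 4 → K) F = 0 := by
    have := aeval_smul_of_isHomogeneous hF (0 : K) (0 : Fin 4 → K)
    rwa [zero_pow hd, zero_mul, smul_zero] at this
  have hz : (0 : Fin 4 → K) ∈ zeros F ⊤ := mem_zeros.mpr ⟨trivial, h0⟩
  rw [← Finset.card_erase_add_one hz, add_comm]
  congr 1
  have hbij : Function.Bijective (fun a : Kˣ × surfacePoints K F =>
      (⟨(a.1 : K) • a.2.1.rep, by
        refine Finset.mem_erase.mpr ⟨smul_ne_zero a.1.ne_zero a.2.1.rep_nonzero,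
          mem_zeros.mpr ⟨trivial, ?_⟩⟩
        rw [aeval_smul_of_isHomogeneous hF, show MvPolynomial.aeval a.2.1.rep F = 0 from a.2.2,
          mul_zero]⟩ : {v // v ∈ (zeros F ⊤).erase 0})) := by
    constructor
    · rintro ⟨a, x, hx⟩ ⟨b, y, hy⟩ h
      have h1 : (a : K) • x.rep = (b : K) • y.rep := congrArg Subtype.val h
      have hxy : x = y := by
        rw [← x.mk_rep, ← y.mk_rep]
        refine (Projectivization.mk_eq_mk_iff' K _ _ x.rep_nonzero y.rep_nonzero).mpr
          ⟨(a : K)⁻¹ * b, ?_⟩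
        rw [mul_smul, ← h1, inv_smul_smul₀ a.ne_zero]
      subst hxy
      have h2 : (a : K) = b := smul_left_injective K x.rep_nonzero h1
      rw [Units.ext h2]
    · rintro ⟨v, hv⟩
      obtain ⟨hv0, hv1⟩ := Finset.mem_erase.mp hv
      obtain ⟨a, ha⟩ := Projectivization.exists_smul_eq_mk_rep K v hv0
      refine ⟨⟨a⁻¹, Projectivization.mk K v hv0,
        (mk_mem_surfacePoints K hF v hv0).mpr (mem_zeros.mp hv1).2⟩, Subtype.ext ?_⟩
      change ((a⁻¹ : Kˣ) : K) • (Projectivization.mk K v hv0).rep = v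
      rw [← ha]
      exact inv_smul_smul a v
  have := Nat.card_eq_of_bijective _ hbij
  rw [Nat.card_prod, Nat.card_eq_fintype_card, Fintype.card_units, Nat.card_coe_set_eq,
    Nat.card_eq_fintype_card, Fintype.card_coe] at this
  exact this.symm

end Points

/-! ### Pencils and tangent planes -/

section Pencils

open scoped Classical

variable {K : Type*} [Field K] [Fintype K] {F : MvPolynomial (Fin 4) K} {d : ℕ}

/-- The `d` lines exhaust the section over the closure by `exists_mem_of_card_eq`, and two of them
already meet only in the vertex. -/
theorem isPlanarPencil_of_linesIn (hd : 2 ≤ d) (hF : F.IsHomogeneous d)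
    {H : Submodule K (Fin 4 → K)} (hH : Module.finrank K H = 3)
    (hHF : ¬ VanishesOn (AlgebraicClosure K) F H) {P : P3 K}
    (hcard : (linesIn (AlgebraicClosure K) F H).card = d)
    (hP : ∀ W ∈ linesIn (AlgebraicClosure K) F H, P.rep ∈ W) :
    IsPlanarPencil d (surfacePoints (AlgebraicClosure K) F ∩ linearPoints (AlgebraicClosure K) H)
      P := by
  obtain ⟨e⟩ : Nonempty (Fin d ≃ linesIn (AlgebraicClosure K) F H) :=
    Fintype.card_eq.mp (by simpa using hcard.symm)
  have he : ∀ i, Module.finrank K (e i).1 = 2 ∧ (e i).1 ≤ H ∧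
    VanishesOn (AlgebraicClosure K) F (e i).1 := fun i => mem_linesIn.mp (e i).2
  have hinj : Function.Injective fun i => (e i).1 := Subtype.val_injective.comp e.injective
  refine ⟨hd, fun i => (e i).1, hinj, fun i => (he i).1, ⟨H, hH, fun i => (he i).2.1⟩, ?_, ?_⟩
  · apply Set.Subset.antisymm
    · rintro x ⟨hxS, hxH⟩
      exact Set.mem_iUnion.mpr (exists_mem_of_card_eq hF hH hHF (Fintype.card_fin d) hinj
        (fun i => (he i).1) (fun i => (he i).2.1) (fun i => (he i).2.2) hxH hxS)
    · refine Set.iUnion_subset fun i => Set.subset_inter ?_ ?_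
      · exact (linearPoints_subset_surfacePoints_iff hF (by omega)).mpr (he i).2.2
      · exact linearPoints_subset_iff.mpr (he i).2.1
  · apply Set.Subset.antisymm
    · intro x hx
      have hx' : ∀ i, x.rep ∈ extendSubmodule (AlgebraicClosure K) (e i).1 :=
        fun i => Set.mem_iInter.mp hx i
      have hne : (e ⟨0, by omega⟩).1 ≠ (e ⟨1, by omega⟩).1 := fun h => by
        simpa using hinj h
      have h1 := inf_eq_span_singleton
        ((finrank_extendSubmodule (AlgebraicClosure K) _).trans (he ⟨0, by omega⟩).1)
        ((finrank_extendSubmodule (AlgebraicClosure K) _).trans (he ⟨1, by omega⟩).1)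
        (fun h => hne (extendSubmodule_injective _ h))
        (extendVec_ne_zero (AlgebraicClosure K) P.rep_nonzero)
        (extendVec_mem_extendSubmodule_of_mem _ (hP _ (e _).2))
        (extendVec_mem_extendSubmodule_of_mem _ (hP _ (e _).2))
      have h2 := Submodule.mem_inf.mpr ⟨hx' ⟨0, by omega⟩, hx' ⟨1, by omega⟩⟩
      rw [h1] at h2
      obtain ⟨c, hc⟩ := Submodule.mem_span_singleton.mp h2
      rw [Set.mem_singleton_iff, ← x.mk_rep, extendPoint]
      exact (Projectivization.mk_eq_mk_iff' _ _ _ _ _).mpr ⟨c, hc⟩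
    · refine Set.singleton_subset_iff.mpr (Set.mem_iInter.mpr fun i => ?_)
      exact extendPoint_mem_linearPoints_iff.mpr (hP _ (e i).2)

/-- Two lines through the vertex are all that uniqueness needs: they span the plane and make it
tangent. -/
theorem IsPlanarPencil.exists_linesIn (hF : F.IsHomogeneous d) {H : Submodule K (Fin 4 → K)}
    {P : P3 K} (h : IsPlanarPencil d
      (surfacePoints (AlgebraicClosure K) F ∩ linearPoints (AlgebraicClosure K) H) P) :
    ∃ W ∈ linesIn (AlgebraicClosure K) F H, ∃ W' ∈ linesIn (AlgebraicClosure K) F H,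
      W ≠ W' ∧ P.rep ∈ W ∧ P.rep ∈ W' := by
  obtain ⟨hd, l, hinj, hl, -, hZ, hv⟩ := h
  have hsub : ∀ i, linearPoints (AlgebraicClosure K) (l i) ⊆
      surfacePoints (AlgebraicClosure K) F ∩ linearPoints (AlgebraicClosure K) H := fun i =>
    hZ ▸ Set.subset_iUnion (fun i => linearPoints (AlgebraicClosure K) (l i)) i
  have hmem : ∀ i, l i ∈ linesIn (AlgebraicClosure K) F H := fun i =>
    mem_linesIn.mpr ⟨hl i, linearPoints_subset_iff.mp ((hsub i).trans Set.inter_subset_right),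
      (linearPoints_subset_surfacePoints_iff hF (by omega)).mp
        ((hsub i).trans Set.inter_subset_left)⟩
  have hP : ∀ i, P.rep ∈ l i := fun i => extendPoint_mem_linearPoints_iff.mp
    (Set.mem_iInter.mp (hv.ge (Set.mem_singleton _)) i)
  exact ⟨l ⟨0, by omega⟩, hmem _, l ⟨1, by omega⟩, hmem _, fun h => by simpa using hinj h,
    hP _, hP _⟩

/-- A tangent plane through a line of the surface. -/
theorem exists_tangent_plane {E : Type*} [Field E] [Algebra K E] [Infinite E]
    (hF : F.IsHomogeneous d) {l : Submodule K (Fin 4 → K)} (hl : Module.finrank K l = 2)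
    (hlF : VanishesOn E F l) {p : Fin 4 → K} (hp : p ∈ l) :
    ∃ H : Submodule K (Fin 4 → K), Module.finrank K H = 3 ∧ l ≤ H ∧
      H ≤ LinearMap.ker (differential F p) := by
  have hle := hlF.le_ker_differential hF hp
  -- The kernel has dimension at least `3`, also at a singular point, so it is larger than `l`.
  obtain ⟨v, hv, hvl⟩ : ∃ v ∈ LinearMap.ker (differential F p), v ∉ l := by
    by_contra! hc
    have h1 := Submodule.finrank_mono (show LinearMap.ker (differential F p) ≤ l from hc)
    have h2 := LinearMap.finrank_range_add_finrank_ker (differential F p)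
    have h3 := Submodule.finrank_le (LinearMap.range (differential F p))
    simp at h2 h3
    omega
  exact ⟨l ⊔ Submodule.span K {v}, by rw [finrank_sup_span_singleton_of_notMem hvl, hl],
    le_sup_left, sup_le hle (by simpa using hv)⟩

theorem le_ker_differential_of_two_lines {E : Type*} [Field E] [Algebra K E] [Infinite E]
    (hF : F.IsHomogeneous d) {H W W' : Submodule K (Fin 4 → K)} (hH : Module.finrank K H = 3)
    (hW : W ∈ linesIn E F H) (hW' : W' ∈ linesIn E F H) (hne : W ≠ W') {p : Fin 4 → K}
    (hp : p ∈ W) (hp' : p ∈ W') : H ≤ LinearMap.ker (differential F p) := by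
  obtain ⟨h1, h2, h3⟩ := mem_linesIn.mp hW
  obtain ⟨h1', h2', h3'⟩ := mem_linesIn.mp hW'
  have hsup : W ⊔ W' = H := by
    apply Submodule.eq_of_le_of_finrank_le (sup_le h2 h2')
    have e1 := Submodule.finrank_sup_add_finrank_inf_eq W W'
    have e2 := finrank_inf_lt_two h1 h1' hne
    omega
  rw [← hsup]
  exact sup_le (h3.le_ker_differential hF hp) (h3'.le_ker_differential hF hp')

end Pencils

end FqSurface

/-! ### Existence and uniqueness of the pencil plane -/

theorem corollary3p6 {K : Type*} [Field K] [Finite K] (q d : ℕ) (hq : Nat.card K = q)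
    (hd2 : 2 ≤ d) (hdq : d ≤ q + 1)
    (F : MvPolynomial (Fin 4) K) (hF0 : F ≠ 0) (hF : F.IsHomogeneous d)
    (hplane : FqSurface.NoPlaneComponent F)
    (hN : (FqSurface.surfacePoints K F).ncard = (d - 1) * q ^ 2 + d * q + 1)
    (P : FqSurface.P3 K) (hP : P ∈ FqSurface.surfacePoints K F) :
    ∃! H : Submodule K (Fin 4 → K),
      FqSurface.IsPlane H ∧
        FqSurface.IsPlanarPencil d
          (FqSurface.surfacePoints (AlgebraicClosure K) F ∩
            FqSurface.linearPoints (AlgebraicClosure K) H) P := by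
  classical
  have := Fintype.ofFinite K
  rw [Nat.card_eq_fintype_card] at hq
  subst hq
  have hd0 : d ≠ 0 := by omega
  have hZ := FqSurface.card_zeros_top hF hd0
  rw [hN] at hZ
  have hnp : ∀ H : Submodule K (Fin 4 → K), Module.finrank K H = 3 →
      ¬ FqSurface.VanishesOn (AlgebraicClosure K) F H := fun H hH h =>
    hplane H hH ((FqSurface.linearPoints_subset_surfacePoints_iff hF hd0).mpr h)
  obtain ⟨l, hl, hPl, hlF⟩ := FqSurface.exists_vanishesOn_of_card_zeros
    (E := AlgebraicClosure K) hd2 hdq hF hZ P.rep_nonzero hP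
  obtain ⟨H, hH, hlH, hHker⟩ := FqSurface.exists_tangent_plane hF hl hlF hPl
  obtain ⟨hcard, hmem⟩ := FqSurface.card_linesIn_eq_and_mem hd2 hdq hF hnp hZ hl hlF hlH hH hPl
    P.rep_nonzero hHker
  refine existsUnique_of_exists_of_unique
    ⟨H, hH, FqSurface.isPlanarPencil_of_linesIn hd2 hF hH (hnp H hH) hcard hmem⟩ ?_
  rintro H₁ H₂ ⟨hH₁, hpen₁⟩ ⟨hH₂, hpen₂⟩
  by_contra hne
  obtain ⟨W₁, hW₁, W₁', hW₁', hne₁, hP₁, hP₁'⟩ := hpen₁.exists_linesIn hF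
  obtain ⟨W₂, hW₂, W₂', hW₂', hne₂, hP₂, hP₂'⟩ := hpen₂.exists_linesIn hF
  have hker₁ := FqSurface.le_ker_differential_of_two_lines hF hH₁ hW₁ hW₁' hne₁ hP₁ hP₁'
  have hker₂ := FqSurface.le_ker_differential_of_two_lines hF hH₂ hW₂ hW₂' hne₂ hP₂ hP₂'
  -- Two distinct planes inside the kernel span the whole space, so `P` is a singular point.
  have hsing : LinearMap.ker (FqSurface.differential F P.rep) = ⊤ := by
    apply Submodule.eq_top_of_finrank_eq
    have h1 : H₁ < H₁ ⊔ H₂ := lt_of_le_of_ne le_sup_left fun h =>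
      hne (Submodule.eq_of_le_of_finrank_eq (sup_eq_left.mp h.symm) (hH₂.trans hH₁.symm)).symm
    have h2 := Submodule.finrank_lt_finrank_of_lt h1
    have h3 := Submodule.finrank_mono (sup_le hker₁ hker₂)
    have h4 := Submodule.finrank_le (LinearMap.ker (FqSurface.differential F P.rep))
    have h5 : Module.finrank K H₁ = 3 := hH₁
    simp at h4 ⊢
    omega
  obtain ⟨Q, hQl, hQP⟩ : ∃ Q ∈ l, Q ∉ Submodule.span K {P.rep} := by
    by_contra! hc
    have h1 := Submodule.finrank_mono (show l ≤ Submodule.span K {P.rep} from hc)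
    rw [hl, finrank_span_singleton P.rep_nonzero] at h1
    omega
  have hQ0 : Q ≠ 0 := fun h => hQP (h ▸ Submodule.zero_mem _)
  obtain ⟨H', hH', hlH', hker'⟩ := FqSurface.exists_tangent_plane hF hl hlF hQl
  obtain ⟨hcard', hmemQ⟩ := FqSurface.card_linesIn_eq_and_mem hd2 hdq hF hnp hZ hl hlF hlH' hH' hQl
    hQ0 hker'
  -- At the singular point `P` every plane through `l` counts as tangent, including the one chosen
  -- tangent at `Q`.
  obtain ⟨-, hmemP⟩ := FqSurface.card_linesIn_eq_and_mem hd2 hdq hF hnp hZ hl hlF hlH' hH' hPl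
    P.rep_nonzero (hsing ▸ le_top)
  obtain ⟨W, hW, W', hW', hWW'⟩ := Finset.one_lt_card.mp (show 1 < _ by rw [hcard']; omega)
  have hinf := FqSurface.inf_eq_span_singleton (FqSurface.mem_linesIn.mp hW).1
    (FqSurface.mem_linesIn.mp hW').1 hWW' P.rep_nonzero (hmemP W hW) (hmemP W' hW')
  exact hQP (hinf ▸ Submodule.mem_inf.mpr ⟨hmemQ W hW, hmemQ W' hW'⟩)
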